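/- Let $n\ge 3$, $m\ge 0$. Let $Z^{\pm}$ be the two complex manifolds of orthogonal complex structures $J$ on $\mathbb R^{2n}$ (distinguished by orientation). For an open set $M\subset\mathbb R^{2n}$ let $Z^{\pm}(M)=M\times Z^{\pm}$ be the twistor space, with the complex structure that at $(x,J)$ is $J$ on horizontal vectors and $B\mapsto JB$ on vertical vectors $B\in T_JZ^\pm$. Let $H$ be the hyperplane bundle on $Z^{\pm}(M)$: $H^{-1}$ is the pull-back to $M\times Z^\pm$ of the tautological line bundle of $Z^{\pm}\subset\mathbf P(\Delta^{\pm})$, whose fibre at $J$ is the line of spinors annihilated by the $(0,1)$-vectors of $J$. Let $e_a=\partial/\partial x_a$, $e^a=dx_a$ $(1\le a\le 2n)$, let $F_{ab}\in\mathfrak{so}(2n)$ be the element with $F_{ab}e_c=\delta_{ac}e_b-\delta_{bc}e_a$, and let $\mathcal F_{ab}$ be the $(1,0)$-part of the vector field on $Z^{\pm}$ induced by $F_{ab}$. On $\Gamma(Z^{\pm}(M),\Lambda^{*}Z^{\pm}(M)\otimes H^{-2n+2-m})$ consider the first-order operator $$D=-\sum_{a,b=1}^{2n}L_{e_a}\,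 i(\overline{\mathcal F_{ab}})\, e^b ,$$ where $L$ is the Lie derivative, $i$ the interior multiplication, and $e^b$ acts by exterior multiplication. Then: 1. $D$ on $Z^{\pm}(\mathbb R^{2n})$ is invariant under the conformal automorphisms $f$ of $\mathbb R^{2n}$: it commutes with the pull-back of sections by the map $(x,J)\mapsto (f(x),\,df_x\,J\,df_x^{-1})$, lifted to $H$ through the spin group with any conformal weight (if $f$ reverses the orientation, the map exchanges $Z^+(\mathbb R^{2n})$ and $Z^-(\mathbb R^{2n})$, is lifted through the pin group, and $D$ on the one corresponds to $D$ on the other). 2. For all $l,l'\ge0$, $D$ maps $\Gamma(Z^{\pm}(M),\Lambda^{l,l'}Z^{\pm}(M)\otimes H^{-2n+2-m})$ into itself. 3. $D^{n+1}=0$. Hence, with $F(x)=\sum_{k\ge0}x^k/(k!)^2$ and $F^{(n+m-2)}$ its $(n+m-2)$-th derivative, the power series $F^{(n+m-2)}(D)$ in $D$ is the finite sum of its terms of degree at most $n$. -/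

import Mathlib

open scoped ContDiff Nat Matrix

attribute [local instance] Matrix.normedAddCommGroup Matrix.normedSpace

noncomputable section

namespace Twistor

/-! ### Euclidean space and its compatible complex structures

The standard basis `e_1, …, e_{2n}` of `ℝ^{2n}` is indexed by `Fin n ⊕ Fin n`: `inl i` stands for
`e_i` and `inr i` for `e_{n+i}`. -/

abbrev Idx (n : ℕ) : Type := Fin n ⊕ Fin n

/-- The Euclidean space `ℝ^{2n}`. -/
abbrev E (n : ℕ) : Type := EuclideanSpace ℝ (Idx n)

abbrev RMat (n : ℕ) : Type := Matrix (Idx n) (Idx n) ℝ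

abbrev CMat (n : ℕ) : Type := Matrix (Idx n) (Idx n) ℂ

/-- The frame vector `e_a = ∂/∂x_a`. -/
def e {n : ℕ} (a : Idx n) : E n := EuclideanSpace.single a 1

/-- An orthogonal complex structure on `ℝ^{2n}`. -/
structure OCS (n : ℕ) where
  mat : RMat n
  orth : matᵀ * mat = 1
  sq : mat * mat = -1

/-- A complex structure, as a complex matrix. -/
def OCS.cmat {n : ℕ} (J : OCS n) : CMat n := J.mat.map Complex.ofReal

theorem OCS.cmat_sq {n : ℕ} (J : OCS n) : J.cmat * J.cmat = -1 := by
  have h := congrArg (fun M : RMat n => M.map (Complex.ofRealHom)) J.sq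
  simp only [Matrix.map_mul] at h
  rw [Matrix.map_neg _ (map_neg _), Matrix.map_one _ (map_zero _) (map_one _)] at h
  exact h

theorem OCS.cmat_transpose {n : ℕ} (J : OCS n) : J.cmatᵀ = -J.cmat := by
  have h1 : J.matᵀ = -J.mat := by
    have h2 : J.matᵀ * (J.mat * J.mat) = J.mat := by
      rw [← Matrix.mul_assoc, J.orth, Matrix.one_mul]
    rw [J.sq, Matrix.mul_neg, Matrix.mul_one] at h2
    rw [eq_neg_iff_add_eq_zero, ← neg_eq_iff_add_eq_zero, h2]
  have h := congrArg (fun M : RMat n => M.map (Complex.ofRealHom)) h1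
  simp only [Matrix.map_neg _ (map_neg Complex.ofRealHom)] at h
  exact h

/-- The two families `Z^+` (`ε = 1`) and `Z^-` (`ε = -1`) of orthogonal complex structures: the
orbits, under orthogonal matrices of determinant `ε`, of the complex structure `e_i ↦ e_{n+i}`,
`e_{n+i} ↦ -e_i`. The twistor space `Z^±(U)` of an open set `U ⊆ ℝ^{2n}` is `U × Z^±`. -/
def Z (n : ℕ) (ε : ℤˣ) : Set (OCS n) :=
  {J | ∃ g : RMat n, gᵀ * g = 1 ∧ g.det = ((ε : ℤ) : ℝ) ∧ J.mat = g * Matrix.J (Fin n) ℝ * gᵀ}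

/-! ### Complexified tangent spaces -/

/-- The complexified tangent space at `J` of the manifold of orthogonal complex structures:
the complexification of `{B | Bᵀ = -B, B J + J B = 0}`. -/
def Vert {n : ℕ} (J : OCS n) : Submodule ℂ (CMat n) where
  carrier := {B | Bᵀ = -B ∧ B * J.cmat = -(J.cmat * B)}
  add_mem' := by
    rintro A B ⟨hA, hA'⟩ ⟨hB, hB'⟩
    refine ⟨by rw [Matrix.transpose_add, hA, hB]; abel, ?_⟩
    rw [Matrix.add_mul, Matrix.mul_add, hA', hB']; abel
  zero_mem' := by simp
  smul_mem' := by
    rintro c B ⟨hB, hB'⟩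
    refine ⟨by rw [Matrix.transpose_smul, hB, smul_neg], ?_⟩
    rw [Matrix.smul_mul, Matrix.mul_smul, hB', smul_neg]

/-- The complexified tangent space of the twistor space at `(x, J)`: horizontal part `ℂ^{2n}`,
vertical part `Vert J`. -/
abbrev Tang {n : ℕ} (J : OCS n) : Type := (Idx n → ℂ) × Vert J

/-- The complex structure `B ↦ J B` on vertical vectors. -/
def vertJ {n : ℕ} (J : OCS n) : Vert J →ₗ[ℂ] Vert J where
  toFun B := ⟨J.cmat * B.1, by
    have hB : B.1ᵀ = -B.1 := B.2.1
    have hB' : B.1 * J.cmat = -(J.cmat * B.1) := B.2.2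
    refine ⟨?_, ?_⟩
    · rw [Matrix.transpose_mul, hB, J.cmat_transpose, neg_mul_neg, hB']
    · rw [Matrix.mul_assoc, hB', Matrix.mul_neg]⟩
  map_add' A B := by ext1; simp [Matrix.mul_add]
  map_smul' c B := by ext1; simp

/-- The complex structure of the twistor space at `(x, J)`, on complexified tangent vectors: `J`
itself on the horizontal part. -/
def tangJ {n : ℕ} (J : OCS n) : Tang J →ₗ[ℂ] Tang J :=
  LinearMap.prodMap (Matrix.mulVecLin J.cmat) (vertJ J)

/-- The (complexified) vector field on the manifold of orthogonal complex structures which is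
induced by `c ∈ so(2n)`: the velocity of `exp(t c) J exp(-t c)` at `t = 0`. -/
def fund {n : ℕ} (c : LieAlgebra.Orthogonal.so (Idx n) ℂ) (J : OCS n) : Vert J :=
  ⟨c.1 * J.cmat - J.cmat * c.1, by
    have hc : c.1ᵀ = -c.1 := (LieAlgebra.Orthogonal.mem_so _ _ _).1 c.2
    refine ⟨?_, ?_⟩
    · rw [Matrix.transpose_sub, Matrix.transpose_mul, Matrix.transpose_mul, hc, J.cmat_transpose,
        neg_mul_neg, neg_mul_neg, neg_sub]
    · rw [Matrix.sub_mul, Matrix.mul_sub, Matrix.mul_assoc, J.cmat_sq,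
        ← Matrix.mul_assoc J.cmat J.cmat, J.cmat_sq, Matrix.mul_neg, Matrix.neg_mul,
        Matrix.mul_one, Matrix.one_mul, Matrix.mul_assoc]
      abel⟩

/-- `F_{ab} = E^a_b - E^b_a ∈ so(2n)`, where `E^a_b e_c = δ^a_c e_b`. -/
def rot {n : ℕ} (a b : Idx n) : LieAlgebra.Orthogonal.so (Idx n) ℂ :=
  ⟨Matrix.single b a 1 - Matrix.single a b 1, by
    rw [LieAlgebra.Orthogonal.mem_so, Matrix.transpose_sub, Matrix.transpose_single,
      Matrix.transpose_single, neg_sub]⟩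

/-- The conjugate of the vector field `ℱ_{ab}`. For the real field `X` induced by `F_{ab}`, the
field `ℱ_{ab}` is the `(1,0)`-part of `X`, and its conjugate is the `(0,1)`-part
`(X + √-1 J X) / 2`. -/
def Fbar {n : ℕ} (a b : Idx n) (J : OCS n) : Vert J :=
  (1 / 2 : ℂ) • (fund (rot a b) J + Complex.I • vertJ J (fund (rot a b) J))

/-! ### The spin module and the powers of the hyperplane bundle -/

/-- The spin module `Δ`, with basis `θ_I`, `I ⊆ {1, …, n}`. -/
abbrev Spinor (n : ℕ) : Type := Finset (Fin n) → ℂ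

/-- The sign of moving `e_i` past the factors `e_j`, `j ∈ I`, `j < i`. -/
def sgn {n : ℕ} (i : Fin n) (I : Finset (Fin n)) : ℂ := (-1) ^ (I.filter (· < i)).card

/-- Clifford multiplication by `e_a` (with `e_a ^ 2 = -1`). If `θ_I = e_{i_1} ⋯ e_{i_k} θ_∅` for
`I = {i_1 < ⋯ < i_k}`, then `e_{n+i} θ_I = √-1 e_i θ_I` for `i ∉ I` and
`e_{n+i} θ_I = -√-1 e_i θ_I` for `i ∈ I`. -/
def gamma {n : ℕ} : Idx n → Module.End ℂ (Spinor n)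
  | Sum.inl i =>
    { toFun := fun ψ I => sgn i I * (if i ∈ I then 1 else -1) * ψ (symmDiff I {i})
      map_add' := fun ψ χ => by ext I; simp [mul_add]
      map_smul' := fun c ψ => by ext I; simp [mul_left_comm] }
  | Sum.inr i =>
    { toFun := fun ψ I => Complex.I * sgn i I * ψ (symmDiff I {i})
      map_add' := fun ψ χ => by ext I; simp [mul_add]
      map_smul' := fun c ψ => by ext I; simp [mul_left_comm] }

/-- Clifford multiplication by a complex vector. -/
def cliff {n : ℕ} (v : Idx n → ℂ) : Module.End ℂ (Spinor n) := ∑ a, v a • gamma a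

/-- Clifford multiplication by a real vector. -/
def rcliff {n : ℕ} (v : E n) : Module.End ℂ (Spinor n) := cliff fun a => (v a : ℂ)

/-- The line of pure spinors of `J`: those annihilated by the `(0,1)`-vectors of `J`. It is the
point of `ℙ(Δ)` which represents `J`, hence the fibre at `J` of the tautological bundle `H⁻¹`. -/
def line {n : ℕ} (J : OCS n) : Submodule ℂ (Spinor n) where
  carrier := {ψ | ∀ v : Idx n → ℂ, J.cmat *ᵥ v = -Complex.I • v → cliff v ψ = 0}
  add_mem' := fun hψ hχ v hv => by rw [map_add, hψ v hv, hχ v hv, add_zero]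
  zero_mem' := fun v _ => map_zero _
  smul_mem' := fun c ψ hψ v hv => by rw [map_smul, hψ v hv, smul_zero]

/-- The tensor power `Δ^{⊗K}`, in coordinates with respect to the `θ_{I_1} ⊗ ⋯ ⊗ θ_{I_K}`. -/
abbrev TensorPow (n K : ℕ) : Type := (Fin K → Finset (Fin n)) → ℂ

/-- `ψ ⊗ ⋯ ⊗ ψ`. -/
def tpow {n : ℕ} (K : ℕ) (ψ : Spinor n) : TensorPow n K := fun I => ∏ j, ψ (I j)

/-- The tensor power `T ⊗ ⋯ ⊗ T` of an endomorphism `T` of `Δ`. -/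
def tmap {n : ℕ} (K : ℕ) (T : Module.End ℂ (Spinor n)) : Module.End ℂ (TensorPow n K) :=
  Matrix.toLin' (Matrix.of fun I I' => ∏ j, T (Pi.single (I' j) 1) (I j))

/-- The fibre of `H^{-K} = (H⁻¹)^{⊗K}` at `J`. -/
def linePow {n : ℕ} (K : ℕ) (J : OCS n) : Submodule ℂ (TensorPow n K) :=
  Submodule.span ℂ (tpow K '' (line J : Set (Spinor n)))

/-! ### Differential forms with values in `H^{-K}` -/

/-- The fibre at `(x, J)` of `Λ^k ⊗ H^{-K}`: complex valued `k`-forms on the tangent space,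
extended complex multilinearly to the complexified tangent space. -/
abbrev Form {n : ℕ} (k K : ℕ) (J : OCS n) : Type := Tang J [⋀^Fin k]→L[ℂ] linePow K J

/-- Not necessarily smooth sections of `Λ^k ⊗ H^{-K}` over `ℝ^{2n} × (Z^+ ∪ Z^-)`. For forms on a
twistor space `U × Z^ε` only the values at its points matter. -/
abbrev Field (n k K : ℕ) : Type := E n → ∀ J : OCS n, Form k K J

/-- A function on the submanifold `U × Z^ε` of `ℝ^{2n} × M_{2n}(ℝ)` is smooth: locally it is the
restriction of a smooth function of the ambient space. -/
def SmoothFun {n : ℕ} {V : Type} [NormedAddCommGroup V] [NormedSpace ℝ V]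
    (U : Set (E n)) (ε : ℤˣ) (h : E n → OCS n → V) : Prop :=
  ∀ x ∈ U, ∀ J ∈ Z n ε, ∃ (O : Set (E n × RMat n)) (G : E n × RMat n → V),
    IsOpen O ∧ (x, J.mat) ∈ O ∧ ContDiffOn ℝ ∞ G O ∧
      ∀ y ∈ U, ∀ J' ∈ Z n ε, (y, J'.mat) ∈ O → h y J' = G (y, J'.mat)

/-- `η` is a smooth section over `U × Z^ε`: its coefficients with respect to the vector fields
`(v, fund c)`, `v` constant and `c ∈ so(2n)`, which span all tangent spaces, are smooth. -/
def IsSection {n k K : ℕ} (U : Set (E n)) (ε : ℤˣ) (η : Field n k K) : Prop :=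
  ∀ (v : Fin k → Idx n → ℂ) (c : Fin k → LieAlgebra.Orthogonal.so (Idx n) ℂ),
    SmoothFun U ε fun x J => (η x J (fun i => (v i, fund (c i) J)) : TensorPow n K)

/-- A form of degree `k` at a point has type `(l, k - l)`: among tuples of vectors, each of type
`(1,0)` or `(0,1)`, it vanishes on those which do not have exactly `l` vectors of type `(1,0)`. -/
def Form.IsType {n k K : ℕ} {J : OCS n} (l : ℕ) (α : Form k K J) : Prop :=
  ∀ (u : Fin k → Tang J) (s : Finset (Fin k)),
    (∀ i ∈ s, tangJ J (u i) = Complex.I • u i) →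
    (∀ i ∉ s, tangJ J (u i) = -Complex.I • u i) → s.card ≠ l → α u = 0

/-- Smooth sections of `Λ^{l,l'} ⊗ H^{-K}` over `U × Z^ε`. -/
def IsTypeSection {n K : ℕ} (U : Set (E n)) (ε : ℤˣ) (l l' : ℕ) (η : Field n (l + l') K) : Prop :=
  IsSection U ε η ∧ ∀ x ∈ U, ∀ J ∈ Z n ε, (η x J).IsType l

/-! ### The operator `D` -/

/-- The horizontal covector `e^b = dx_b`. -/
def coframe {n : ℕ} (J : OCS n) (b : Idx n) : Tang J →L[ℂ] ℂ :=
  (ContinuousLinearMap.proj b).comp (ContinuousLinearMap.fst ℂ (Idx n → ℂ) (Vert J))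

/-- Exterior multiplication by `e^b`:
`(e^b ∧ α)(u_0, …, u_k) = ∑ (-1)^i e^b(u_i) α(u_0, …, û_i, …, u_k)`. -/
def wedge {n k K : ℕ} {J : OCS n} (b : Idx n) (α : Form k K J) : Form (k + 1) K J :=
  ContinuousAlternatingMap.alternatizeUncurryFin ((coframe J b).smulRight α)

/-- Interior multiplication by a vertical vector. -/
def interior {n k K : ℕ} {J : OCS n} (B : Vert J) (α : Form (k + 1) K J) : Form k K J :=
  α.curryLeft (0, B)

/-- The Lie derivative along `e_a`: the derivative at `t = 0` of the pull-back by the flow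
`(x, J) ↦ (x + t e_a, J)`. The differential of this flow is the identity of `Tang J`, and, as the
Hermitian bundle `H` is pulled back from `Z^ε`, so is its parallel transport along the flow. -/
def lie {n k K : ℕ} (a : Idx n) (η : Field n k K) : Field n k K := fun x J =>
  deriv (fun t : ℝ => η (x + t • e a) J) 0

/-- The operator `D = - ∑_{a,b} L_{e_a} i(conj ℱ_{ab}) e^b`. -/
def D {n k K : ℕ} (η : Field n k K) : Field n k K := fun x J =>
  -∑ a, ∑ b, lie a (fun y J' => interior (Fbar a b J') (wedge b (η y J'))) x J

/-- The power series `F(x) = ∑ x^k / (k!)^2`. -/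
def F : PowerSeries ℂ := PowerSeries.mk fun k => 1 / ((k ! : ℂ)) ^ 2

/-- The `j`-th derivative of the power series `F`. -/
def Fder (j : ℕ) : PowerSeries ℂ := (PowerSeries.derivative ℂ)^[j] F

/-! ### Conformal automorphisms and their action -/

/-- A conformal automorphism of `ℝ^{2n}`: a smooth diffeomorphism whose differential is everywhere
a non-zero multiple of an isometry. -/
structure IsConformalAut {n : ℕ} (f : E n ≃ E n) : Prop where
  smooth : ContDiff ℝ ∞ f
  smooth_symm : ContDiff ℝ ∞ f.symm
  conformal : Conformal f

/-- The Jacobian matrix of `f` at `x`. -/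
def jac {n : ℕ} (f : E n → E n) (x : E n) : RMat n := Matrix.of fun b a => fderiv ℝ f x (e a) b

/-- The map `(x, J) ↦ (f x, df_x J df_x⁻¹)` which `f` induces on the twistor space, as a map of
the ambient space. -/
def lift {n : ℕ} (f : E n → E n) (p : E n × RMat n) : E n × RMat n :=
  (f p.1, jac f p.1 * p.2 * (jac f p.1)⁻¹)

/-- The differential at `(x, J)` of the map induced by `f` on the twistor space, on complexified
tangent vectors `(v, B)`. -/
def dlift {n : ℕ} (f : E n → E n) (x : E n) (J : OCS n) (v : Idx n → ℂ) (B : CMat n) :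
    (Idx n → ℂ) × CMat n :=
  let re := fderiv ℝ (lift f) (x, J.mat) (WithLp.toLp 2 fun a => (v a).re, B.map Complex.re)
  let im := fderiv ℝ (lift f) (x, J.mat) (WithLp.toLp 2 fun a => (v a).im, B.map Complex.im)
  (fun a => (re.1 a : ℂ) + Complex.I * (im.1 a : ℂ),
    re.2.map Complex.ofReal + Complex.I • im.2.map Complex.ofReal)

/-- The group `Pin(2n)` in `End Δ`: products of unit vectors. (The inverse of a unit vector `v` is
`-v`.) The products which cover rotations form `Spin(2n)`. -/
def Pin (n : ℕ) : Submonoid (Module.End ℂ (Spinor n)) :=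
  Submonoid.closure {T | ∃ v : E n, ‖v‖ = 1 ∧ T = rcliff v}

/-- `S` is a lift to the pin group of the family of orthogonal maps `df_x / |df_x|` (where `δ` is
the sign of the determinant of `df_x`, so that `S x ∈ Spin(2n)` if `δ = 1`). -/
structure IsPinLift {n : ℕ} (f : E n → E n) (δ : ℤˣ) (S : E n → Module.End ℂ (Spinor n)) :
    Prop where
  mem : ∀ x, S x ∈ Pin n
  cont : ∀ ψ, Continuous fun x => S x ψ
  covers : ∀ (x v : E n) (ψ : Spinor n),
    (‖fderiv ℝ f x‖ : ℂ) • S x (rcliff v ψ) =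
      ((δ : ℤ) : ℂ) • rcliff (fderiv ℝ f x v) (S x ψ)

/-- `η'` is the pull-back of `η` to `ℝ^{2n} × Z^ε` by the map induced by `f`, where `H⁻¹` is mapped
by `|df_x|^w S x` (`w` is the conformal weight). -/
def IsPullback {n k K : ℕ} (ε : ℤˣ) (f : E n → E n) (w : ℝ) (S : E n → Module.End ℂ (Spinor n))
    (η η' : Field n k K) : Prop :=
  ∀ (x : E n), ∀ J ∈ Z n ε, ∀ J' : OCS n, (f x, J'.mat) = lift f (x, J.mat) →
    ∀ (u : Fin k → Tang J) (u' : Fin k → Tang J'),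
      (∀ i, ((u' i).1, ((u' i).2 : CMat n)) = dlift f x J (u i).1 (u i).2) →
      tmap K (((‖fderiv ℝ f x‖ ^ w : ℝ) : ℂ) • S x) (η' x J u : TensorPow n K) =
        (η (f x) J' u' : TensorPow n K)

end Twistor

end

noncomputable section

namespace Twistor

variable {n k K : ℕ}

/-! ### Pointwise linear algebra -/

/-! Since `e^b` vanishes on vertical vectors, `∑ b, i(ℱ̄_{ab}) e^b` is minus the derivation on forms
which extends the endomorphism `nil J a : (v, B) ↦ (0, ∑ v_b ℱ̄_{ab})` of the tangent space. So `D`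
replaces one argument `u i` by `nil J a (u i)`, differentiates along `e_a`, and sums over `a` and
`i` (`HorDiff.D_apply`). The three assertions become statements about `nil`.

Type: `nil` kills vectors of type `(1,0)` and takes values of type `(0,1)`, so replacing an argument
never changes the number of arguments of type `(1,0)` in a surviving term.

Nilpotency: `nil` kills everything whose horizontal `(0,1)`-part is zero, in particular its own
values. The horizontal `(0,1)`-vectors form a space of dimension `n`, so a tuple of distinct vectors
from an adapted basis has at most `n` entries on which `nil` can act, and each application of `D`
uses up one of them.

Conformal invariance: by Liouville's theorem (`fderiv_eq_of_conformal`) a conformal automorphism in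
dimension at least three has constant differential. A continuous pin lift is then constant as well
(`IsPinLift.eq_of_fderiv_eq`), so the pull-back commutes with differentiation up to the chain rule.
What remains is the equivariance of `nil` under a linear similarity (`Intertwines.sum_push_nil`), in
which the scale factor cancels. -/

theorem alternatizeUncurryFin_smulRight_apply_vecCons {V W : Type*} [NormedAddCommGroup V]
    [NormedSpace ℂ V] [NormedAddCommGroup W] [NormedSpace ℂ W] (ξ : V →L[ℂ] ℂ)
    (α : V [⋀^Fin k]→L[ℂ] W) (z : V) (hz : ξ z = 0) (u : Fin k → V) :
    ContinuousAlternatingMap.alternatizeUncurryFin (ξ.smulRight α) (Matrix.vecCons z u)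
      = -∑ i, ξ (u i) • α (Function.update u i z) := by
  -- The term omitting `z` vanishes because `ξ z = 0`. In the term omitting `u i`, of sign
  -- `(-1)^(i+1)`, moving `z` from the front to slot `i` costs `(-1)^i`; this leaves the sign `-1`.
  rw [ContinuousAlternatingMap.alternatizeUncurryFin_apply, Fin.sum_univ_succ]
  have h0 : ξ.smulRight α (Matrix.vecCons z u 0) = 0 := by simp [hz]
  rw [h0, ContinuousAlternatingMap.coe_zero, Pi.zero_apply, smul_zero, zero_add, ← Finset.sum_neg_distrib]
  refine Finset.sum_congr rfl fun i _ => ?_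
  cases k with
  | zero => exact i.elim0
  | succ k =>
    have hi : Function.update u i z = i.insertNth z (i.removeNth u) := by
      rw [Fin.insertNth_removeNth]
    rw [hi, ContinuousAlternatingMap.map_insertNth]
    have hr : (Fin.succ i).removeNth (Matrix.vecCons z u) = Matrix.vecCons z (i.removeNth u) := by
      funext j
      refine Fin.cases ?_ (fun j => ?_) j <;> simp [Fin.removeNth]
    rw [hr]
    simp [pow_succ, smul_comm (ξ (u i))]

theorem interior_wedge_apply {J : OCS n} (B : Vert J) (b : Idx n) (α : Form k K J)
    (u : Fin k → Tang J) :
    interior B (wedge b α) u = -∑ i, (u i).1 b • α (Function.update u i (0, B)) :=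
  alternatizeUncurryFin_smulRight_apply_vecCons (coframe J b) α (0, B) rfl u

/-- The nilpotent endomorphism `(v, B) ↦ (0, ∑ v_b ℱ̄_{ab})` of the tangent space. -/
def nil (J : OCS n) (a : Idx n) : Tang J →ₗ[ℂ] Tang J :=
  LinearMap.inr ℂ _ _ ∘ₗ (∑ b, (LinearMap.proj b).smulRight (Fbar a b J)) ∘ₗ LinearMap.fst ℂ _ _

theorem nil_apply (J : OCS n) (a : Idx n) (u : Tang J) :
    nil J a u = (0, ∑ b, u.1 b • Fbar a b J) := by
  simp [nil]

theorem nil_nil (J : OCS n) (a a' : Idx n) (u : Tang J) : nil J a (nil J a' u) = 0 := by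
  rw [nil_apply J a, nil_apply J a']; simp

theorem sum_interior_wedge_apply {J : OCS n} (a : Idx n) (α : Form k K J) (u : Fin k → Tang J) :
    (∑ b, interior (Fbar a b J) (wedge b α)) u
      = -∑ i, α (Function.update u i (nil J a (u i))) := by
  simp only [ContinuousAlternatingMap.sum_apply, interior_wedge_apply, Finset.sum_neg_distrib]
  rw [Finset.sum_comm]
  congr 1
  refine Finset.sum_congr rfl fun i _ => ?_
  have : nil J a (u i) = ∑ b, (u i).1 b • ((0, Fbar a b J) : Tang J) := by
    rw [nil_apply, Prod.ext_iff]
    simp [Prod.fst_sum, Prod.snd_sum]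
  rw [this]
  have h := map_sum (α.toMultilinearMap.toLinearMap u i)
    (fun b => (u i).1 b • ((0, Fbar a b J) : Tang J)) Finset.univ
  simp only [map_smul] at h
  exact h.symm

/-- The projection to the `(0,1)`-vectors. -/
def projBar (J : OCS n) : CMat n := (1 / 2 : ℂ) • (1 + Complex.I • J.cmat)

theorem projBar_mul_self (J : OCS n) : projBar J * projBar J = projBar J := by
  simp only [projBar, Matrix.smul_mul, Matrix.mul_smul, Matrix.add_mul, Matrix.mul_add,
    Matrix.one_mul, Matrix.mul_one, J.cmat_sq, smul_smul]
  ext i j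
  simp
  ring_nf
  simp
  ring

theorem vertJ_Fbar (J : OCS n) (a b : Idx n) :
    vertJ J (Fbar a b J) = -Complex.I • Fbar a b J := by
  have hsq : ∀ B : Vert J, vertJ J (vertJ J B) = -B := by
    intro B
    ext1
    simp [vertJ, ← Matrix.mul_assoc, J.cmat_sq]
  have hI : -Complex.I * (1 / 2 * Complex.I) = 1 / 2 := by
    linear_combination (-1 / 2) * Complex.I_mul_I
  simp only [Fbar, map_smul, map_add, hsq, smul_smul, smul_add, smul_neg, hI]
  module

theorem tangJ_nil (J : OCS n) (a : Idx n) (u : Tang J) :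
    tangJ J (nil J a u) = -Complex.I • nil J a u := by
  rw [nil_apply, tangJ, LinearMap.prodMap_apply]
  simp only [map_zero, map_sum, map_smul, vertJ_Fbar, Prod.smul_mk, smul_zero, Finset.smul_sum,
    smul_comm (-Complex.I)]

/-- `ℱ̄_{ab}` in terms of the `(0,1)`-parts of `e_a` and `e_b`. -/
theorem Fbar_coe (J : OCS n) (a b : Idx n) :
    (Fbar a b J : CMat n) = (2 * Complex.I) •
      (projBar J * ((rot a b).1 * (projBar J)ᵀ)) := by
  have hJ := J.cmat_sq
  change (1 / 2 : ℂ) • ((rot a b).1 * J.cmat - J.cmat * (rot a b).1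
    + Complex.I • (J.cmat * ((rot a b).1 * J.cmat - J.cmat * (rot a b).1))) = _
  simp only [projBar, Matrix.transpose_smul, Matrix.transpose_add,
    Matrix.transpose_one, J.cmat_transpose]
  generalize J.cmat = M at *
  generalize (rot a b).1 = F
  simp only [Matrix.mul_sub, ← Matrix.mul_assoc, hJ, Matrix.mul_add, Matrix.add_mul, Matrix.smul_mul,
    Matrix.mul_smul, Matrix.mul_one, Matrix.one_mul, Matrix.neg_mul, Matrix.mul_neg]
  ext i j
  simp
  ring_nf
  simp
  ring

/-- This closed form depends on `u.1` and on the basis vector only through their images under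
`projBar J`. It yields both the kernel of `nil` and its behaviour under similarities. -/
theorem nil_snd_coe (J : OCS n) (a : Idx n) (u : Tang J) :
    ((nil J a u).2 : CMat n) = (2 * Complex.I) • (projBar J *
      ((Matrix.vecMulVec u.1 (Pi.single a 1) - Matrix.vecMulVec (Pi.single a 1) u.1) *
        (projBar J)ᵀ)) := by
  have h1 : ∑ b, u.1 b • (rot a b).1 = Matrix.vecMulVec u.1 (Pi.single a 1)
      - Matrix.vecMulVec (Pi.single a 1) u.1 := by
    ext i j
    simp [rot, Matrix.sum_apply, Matrix.vecMulVec_apply, Matrix.single_apply, Pi.single_apply,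
      mul_sub, Finset.sum_sub_distrib, ite_and, eq_comm]
  have h2 : ∀ b, u.1 b • (Fbar a b J : CMat n) = (2 * Complex.I) •
      (projBar J * ((u.1 b • (rot a b).1) * (projBar J)ᵀ)) := fun b => by
    rw [Fbar_coe, smul_comm, Matrix.smul_mul, Matrix.mul_smul]
  rw [nil_apply, AddSubmonoidClass.coe_finsetSum]
  simp only [Submodule.coe_smul, h2]
  rw [← Finset.smul_sum, ← Matrix.mul_sum, ← Matrix.sum_mul, h1]

theorem nil_eq_zero (J : OCS n) (a : Idx n) (u : Tang J) (h : projBar J *ᵥ u.1 = 0) :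
    nil J a u = 0 := by
  ext1
  · rw [nil_apply]; rfl
  · ext1
    rw [nil_snd_coe, Matrix.sub_mul, Matrix.mul_sub,
      Matrix.vecMulVec_mul, Matrix.vecMulVec_mul, Matrix.mul_vecMulVec, Matrix.mul_vecMulVec,
      Matrix.vecMul_transpose, Matrix.vecMul_transpose, h]
    simp

theorem projBar_mulVec_eq_zero (J : OCS n) (v : Idx n → ℂ) (h : J.cmat *ᵥ v = Complex.I • v) :
    projBar J *ᵥ v = 0 := by
  rw [projBar, Matrix.smul_mulVec, Matrix.add_mulVec, Matrix.smul_mulVec, h, smul_smul,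
    Complex.I_mul_I]
  simp

theorem nil_eq_zero_of_type (J : OCS n) (a : Idx n) (u : Tang J)
    (h : tangJ J u = Complex.I • u) : nil J a u = 0 :=
  nil_eq_zero J a u (projBar_mulVec_eq_zero J u.1 (congrArg Prod.fst h))

theorem trace_cmat (J : OCS n) : J.cmat.trace = 0 := by
  have h := congrArg Matrix.trace J.cmat_transpose
  rw [Matrix.trace_transpose, Matrix.trace_neg] at h
  exact self_eq_neg.1 h

/-- The rank of an idempotent is its trace, and `J` is skew, hence traceless, so the trace is half
of `2n`. -/
theorem finrank_range_projBar (J : OCS n) :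
    Module.finrank ℂ (LinearMap.range (Matrix.toLin' (projBar J))) = n := by
  have hid : IsIdempotentElem (Matrix.toLin' (projBar J)) := by
    rw [IsIdempotentElem, Module.End.mul_eq_comp, ← Matrix.toLin'_mul, projBar_mul_self]
  have h := LinearMap.IsProj.trace (LinearMap.IsIdempotentElem.isProj_range _ hid)
  have h1 : (projBar J).trace = n := by
    rw [projBar, Matrix.trace_smul, Matrix.trace_add, Matrix.trace_smul, trace_cmat]
    simp
    ring
  rw [Matrix.trace_toLin'_eq, h1] at h
  exact_mod_cast h.symm

/-- Every vertical vector is induced by an element of `so(2n)`. -/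
theorem exists_fund_eq (J : OCS n) (B : Vert J) : ∃ c, fund c J = B := by
  have h1 : B.1ᵀ = -B.1 := B.2.1
  have h2 : B.1 * J.cmat = -(J.cmat * B.1) := B.2.2
  -- For `c = -BJ/2`, the relations `J² = -1` and `BJ = -JB` give `cJ = B/2` and `Jc = -B/2`.
  refine ⟨⟨(-1 / 2 : ℂ) • (B.1 * J.cmat), ?_⟩, ?_⟩
  · rw [LieAlgebra.Orthogonal.mem_so, Matrix.transpose_smul, Matrix.transpose_mul, h1,
      J.cmat_transpose, neg_mul_neg, h2, smul_neg, neg_neg]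
  · ext1
    simp only [fund, Matrix.smul_mul, Matrix.mul_smul]
    rw [← Matrix.mul_assoc, ← neg_eq_iff_eq_neg.2 h2, Matrix.neg_mul, Matrix.mul_assoc, J.cmat_sq]
    ext i j
    simp
    ring

end Twistor

end

noncomputable section

namespace Twistor

variable {n k K : ℕ}

/-! ### Differentiation of forms -/

/-- A form is recovered, linearly and hence continuously in finite dimension, from its values on
tuples of basis vectors. This reduces differentiability of a family of forms to that of its
coefficients. -/
theorem exists_leftInverse_eval {V W : Type*} [NormedAddCommGroup V]
    [NormedSpace ℂ V] [NormedAddCommGroup W] [NormedSpace ℂ W] [FiniteDimensional ℂ V]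
    [FiniteDimensional ℂ W] (k : ℕ) :
    ∃ L : ((Fin k → Fin (Module.finrank ℂ V)) → W) →L[ℂ] (V [⋀^Fin k]→L[ℂ] W),
      ∀ α : V [⋀^Fin k]→L[ℂ] W, L (fun s => α fun i => Module.finBasis ℂ V (s i)) = α := by
  let ev : (V [⋀^Fin k]→L[ℂ] W) →ₗ[ℂ] ((Fin k → Fin (Module.finrank ℂ V)) → W) :=
    { toFun := fun α s => α fun i => Module.finBasis ℂ V (s i)
      map_add' := fun _ _ => rfl
      map_smul' := fun _ _ => rfl }
  have hinj : LinearMap.ker ev = ⊥ := by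
    rw [LinearMap.ker_eq_bot]
    intro α β h
    have h2 : α.toMultilinearMap = β.toMultilinearMap :=
      Module.Basis.ext_multilinear (fun _ => Module.finBasis ℂ V) fun s => congrFun h s
    ext u
    exact congrArg (fun q : MultilinearMap ℂ (fun _ : Fin k => V) W => q u) h2
  obtain ⟨L, hL⟩ := ev.exists_leftInverse_of_injective hinj
  exact ⟨LinearMap.toContinuousLinearMap L, fun α => LinearMap.congr_fun hL α⟩

theorem differentiableAt_of_apply {V W : Type*} [NormedAddCommGroup V]
    [NormedSpace ℂ V] [NormedAddCommGroup W] [NormedSpace ℂ W] [FiniteDimensional ℂ V]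
    [FiniteDimensional ℂ W] {g : ℝ → V [⋀^Fin k]→L[ℂ] W} {t : ℝ}
    (h : ∀ u, DifferentiableAt ℝ (fun t => g t u) t) : DifferentiableAt ℝ g t := by
  obtain ⟨L, hL⟩ := exists_leftInverse_eval (V := V) (W := W) k
  have h1 : DifferentiableAt ℝ (fun t (s : Fin k → Fin (Module.finrank ℂ V)) => g t fun i => Module.finBasis ℂ V (s i)) t :=
    differentiableAt_pi.2 fun s => h _
  have h2 := (L.restrictScalars ℝ).differentiableAt.comp t h1
  simpa only [ContinuousLinearMap.coe_restrictScalars', Function.comp_def, hL] using h2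

theorem hasDerivAt_apply {V W : Type*} [NormedAddCommGroup V]
    [NormedSpace ℂ V] [NormedAddCommGroup W] [NormedSpace ℂ W]
    {g : ℝ → V [⋀^Fin k]→L[ℂ] W} {α : V [⋀^Fin k]→L[ℂ] W} {t : ℝ}
    (h : HasDerivAt g α t) (u : Fin k → V) : HasDerivAt (fun t => g t u) (α u) t :=
  ((ContinuousAlternatingMap.apply ℂ V W u).restrictScalars ℝ).hasFDerivAt.comp_hasDerivAt t h

/-- The inclusion of a subspace of `TensorPow`, over the reals. -/
def coeReal (W : Submodule ℂ (TensorPow n K)) : W →L[ℝ] TensorPow n K :=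
  W.subtypeL.restrictScalars ℝ

/-- A linear left inverse of the inclusion carries derivatives back to the subspace. Coefficients
can thus be differentiated in the fixed space `TensorPow n K` rather than in the fibre, which varies
with `J`. -/
theorem hasDerivAt_coe_iff {W : Submodule ℂ (TensorPow n K)} {g : ℝ → W} {g' : W} {t : ℝ} :
    HasDerivAt (fun t => (g t : TensorPow n K)) (g' : TensorPow n K) t ↔ HasDerivAt g g' t := by
  refine ⟨fun h => ?_, fun h => (coeReal W).hasFDerivAt.comp_hasDerivAt t h⟩
  obtain ⟨L, hL⟩ := W.subtype.exists_leftInverse_of_injective W.ker_subtype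
  have h2 := ((LinearMap.toContinuousLinearMap L).restrictScalars ℝ).hasFDerivAt.comp_hasDerivAt t h
  have h3 : ∀ w : W, L w = w := fun w => LinearMap.congr_fun hL w
  simpa only [ContinuousLinearMap.coe_restrictScalars', Function.comp_def,
    LinearMap.coe_toContinuousLinearMap', h3] using h2

theorem differentiableAt_coe {W : Submodule ℂ (TensorPow n K)} {g : ℝ → W} {t : ℝ}
    (h : DifferentiableAt ℝ (fun t => (g t : TensorPow n K)) t) : DifferentiableAt ℝ g t := by
  obtain ⟨L, hL⟩ := W.subtype.exists_leftInverse_of_injective W.ker_subtype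
  have h2 := ((LinearMap.toContinuousLinearMap L).restrictScalars ℝ).differentiableAt.comp t h
  have h3 : ∀ w : W, L w = w := fun w => LinearMap.congr_fun hL w
  simpa only [ContinuousLinearMap.coe_restrictScalars', Function.comp_def,
    LinearMap.coe_toContinuousLinearMap', h3] using h2

theorem deriv_apply_of_apply {V W : Type*} [NormedAddCommGroup V]
    [NormedSpace ℂ V] [NormedAddCommGroup W] [NormedSpace ℂ W] [FiniteDimensional ℂ V]
    [FiniteDimensional ℂ W] {g : ℝ → V [⋀^Fin k]→L[ℂ] W} {t : ℝ}
    (h : ∀ u, DifferentiableAt ℝ (fun t => g t u) t) (u : Fin k → V) :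
    deriv g t u = deriv (fun t => g t u) t :=
  (hasDerivAt_apply (differentiableAt_of_apply h).hasDerivAt u).deriv.symm

theorem deriv_coe {W : Submodule ℂ (TensorPow n K)} {g : ℝ → W} {t : ℝ}
    (h : DifferentiableAt ℝ (fun t => (g t : TensorPow n K)) t) :
    ((deriv g t : W) : TensorPow n K) = deriv (fun t => (g t : TensorPow n K)) t :=
  (hasDerivAt_coe_iff.2 (differentiableAt_coe h).hasDerivAt).deriv.symm

/-- The coefficients of `η` are differentiable at `(x, J)` in the horizontal directions. -/
def HorDiff (η : Field n k K) (x : E n) (J : OCS n) : Prop :=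
  ∀ a u, DifferentiableAt ℝ (fun t : ℝ => (η (x + t • e a) J u : TensorPow n K)) 0

/-- The derivative along `e_a` of a coefficient of `η`. -/
def hderiv (a : Idx n) (η : Field n k K) (x : E n) (J : OCS n) (u : Fin k → Tang J) :
    TensorPow n K :=
  deriv (fun t : ℝ => (η (x + t • e a) J u : TensorPow n K)) 0

theorem HorDiff.hasDerivAt {η : Field n k K} {x : E n} {J : OCS n} (h : HorDiff η x J)
    (a : Idx n) (u : Fin k → Tang J) :
    HasDerivAt (fun t : ℝ => (η (x + t • e a) J u : TensorPow n K)) (hderiv a η x J u) 0 :=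
  (h a u).hasDerivAt

/-- Differentiability matters here: `deriv` is zero by default, and this might happen to the whole
form while single coefficients have derivatives. -/
theorem HorDiff.coe_lie_apply {η : Field n k K} {x : E n} {J : OCS n} (h : HorDiff η x J)
    (a : Idx n) (u : Fin k → Tang J) : (lie a η x J u : TensorPow n K) = hderiv a η x J u := by
  have h1 : lie a η x J u = deriv (fun t : ℝ => η (x + t • e a) J u) 0 :=
    deriv_apply_of_apply (g := fun t : ℝ => η (x + t • e a) J) (t := 0)
      (fun u => differentiableAt_coe (h a u)) u
  rw [h1]
  exact deriv_coe (h a u)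

theorem coe_interior_wedge_apply {J : OCS n} (B : Vert J) (b : Idx n) (α : Form k K J)
    (u : Fin k → Tang J) :
    (interior B (wedge b α) u : TensorPow n K)
      = -∑ i, (u i).1 b • (α (Function.update u i (0, B)) : TensorPow n K) := by
  rw [interior_wedge_apply]
  simp

theorem HorDiff.hasDerivAt_interior_wedge {η : Field n k K} {x : E n} {J : OCS n}
    (h : HorDiff η x J) (a b c : Idx n) (u : Fin k → Tang J) :
    HasDerivAt (fun t : ℝ => (interior (Fbar b c J) (wedge c (η (x + t • e a) J)) u :
      TensorPow n K)) (interior (Fbar b c J) (wedge c (lie a η x J)) u : TensorPow n K) 0 := by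
  simp only [coe_interior_wedge_apply, h.coe_lie_apply]
  exact HasDerivAt.neg (HasDerivAt.fun_sum fun i _ => (h.hasDerivAt a _).const_smul ((u i).1 c))

theorem HorDiff.lie_interior_wedge {η : Field n k K} {x : E n} {J : OCS n} (h : HorDiff η x J)
    (a b c : Idx n) :
    lie a (fun y J' => interior (Fbar b c J') (wedge c (η y J'))) x J
      = interior (Fbar b c J) (wedge c (lie a η x J)) := by
  have h' : HorDiff (fun y J' => interior (Fbar b c J') (wedge c (η y J'))) x J :=
    fun a u => (h.hasDerivAt_interior_wedge a b c u).differentiableAt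
  refine ContinuousAlternatingMap.ext fun u => ?_
  refine Subtype.ext ?_
  rw [h'.coe_lie_apply]
  exact (h.hasDerivAt_interior_wedge a b c u).deriv

/-- The working formula for `D`. The sign in its definition cancels the sign from moving the
interior product past `e^b`. -/
theorem HorDiff.D_apply {η : Field n k K} {x : E n} {J : OCS n} (h : HorDiff η x J)
    (u : Fin k → Tang J) :
    (D η x J u : TensorPow n K)
      = ∑ i, ∑ a, hderiv a η x J (Function.update u i (nil J a (u i))) := by
  have h1 : D η x J = -∑ a, ∑ b, interior (Fbar a b J) (wedge b (lie a η x J)) := by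
    simp only [D, h.lie_interior_wedge]
  have h2 : D η x J u = ∑ i, ∑ a, lie a η x J (Function.update u i (nil J a (u i))) := by
    rw [h1, Finset.sum_comm (γ := Fin k), ContinuousAlternatingMap.neg_apply,
      ContinuousAlternatingMap.sum_apply, ← Finset.sum_neg_distrib]
    refine Finset.sum_congr rfl fun a _ => ?_
    rw [sum_interior_wedge_apply, neg_neg]
  rw [h2]
  simp only [AddSubmonoidClass.coe_finsetSum, h.coe_lie_apply]

end Twistor

end

noncomputable section

namespace Twistor

variable {n k K : ℕ}

/-! ### Smooth functions and sections -/

section SmoothFun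

variable {V : Type} [NormedAddCommGroup V] [NormedSpace ℝ V] {U : Set (E n)} {ε : ℤˣ}

theorem SmoothFun.congr {h h' : E n → OCS n → V} (hh : SmoothFun U ε h)
    (heq : ∀ x ∈ U, ∀ J ∈ Z n ε, h' x J = h x J) : SmoothFun U ε h' := by
  intro x hx J hJ
  obtain ⟨O, G, hO, hxO, hG, hGh⟩ := hh x hx J hJ
  exact ⟨O, G, hO, hxO, hG, fun y hy J' hJ' hO' => by rw [heq y hy J' hJ', hGh y hy J' hJ' hO']⟩

theorem smoothFun_zero : SmoothFun U ε (fun _ _ => (0 : V)) := fun _ _ _ _ =>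
  ⟨Set.univ, fun _ => 0, isOpen_univ, trivial, contDiffOn_const, fun _ _ _ _ _ => rfl⟩

theorem SmoothFun.add {h h' : E n → OCS n → V} (hh : SmoothFun U ε h) (hh' : SmoothFun U ε h') :
    SmoothFun U ε (fun x J => h x J + h' x J) := by
  intro x hx J hJ
  obtain ⟨O, G, hO, hxO, hG, hGh⟩ := hh x hx J hJ
  obtain ⟨O', G', hO', hxO', hG', hGh'⟩ := hh' x hx J hJ
  refine ⟨O ∩ O', fun p => G p + G' p, hO.inter hO', ⟨hxO, hxO'⟩,
    (hG.mono Set.inter_subset_left).add (hG'.mono Set.inter_subset_right), ?_⟩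
  rintro y hy J' hJ' ⟨h1, h2⟩
  exact congrArg₂ (· + ·) (hGh y hy J' hJ' h1) (hGh' y hy J' hJ' h2)

theorem smoothFun_sum {ι : Type*} (s : Finset ι) {h : ι → E n → OCS n → V}
    (hh : ∀ i ∈ s, SmoothFun U ε (h i)) : SmoothFun U ε (fun x J => ∑ i ∈ s, h i x J) := by
  classical
  induction s using Finset.induction_on with
  | empty => simpa using smoothFun_zero
  | insert i s hi ih =>
    simp only [Finset.sum_insert hi]
    exact (hh i (Finset.mem_insert_self i s)).add
      (ih fun j hj => hh j (Finset.mem_insert_of_mem hj))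

theorem SmoothFun.smul [NormedSpace ℂ V] [IsScalarTower ℝ ℂ V] {h : E n → OCS n → V} (hh : SmoothFun U ε h)
    {r : RMat n → ℂ} (hr : ContDiff ℝ ∞ r) : SmoothFun U ε (fun x J => r J.mat • h x J) := by
  intro x hx J hJ
  obtain ⟨O, G, hO, hxO, hG, hGh⟩ := hh x hx J hJ
  refine ⟨O, fun p => r p.2 • G p, hO, hxO, (hr.comp contDiff_snd).contDiffOn.smul hG, ?_⟩
  intro y hy J' hJ' h1
  exact congrArg (r J'.mat • ·) (hGh y hy J' hJ' h1)

/-- A short horizontal segment stays in `U` and in `O` with `J` fixed, so `h` agrees with its local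
extension `G` along it. One `G` serves all points of `O`, which is why horizontal derivatives are
again smooth. -/
theorem SmoothFun.hasDerivAt_aux (hU : IsOpen U) {h : E n → OCS n → V}
    {O : Set (E n × RMat n)} {G : E n × RMat n → V} (hO : IsOpen O) (hG : ContDiffOn ℝ ∞ G O)
    (hGh : ∀ y ∈ U, ∀ J' ∈ Z n ε, (y, J'.mat) ∈ O → h y J' = G (y, J'.mat)) {y : E n}
    (hy : y ∈ U) {J : OCS n} (hJ : J ∈ Z n ε) (hyO : (y, J.mat) ∈ O) (v : E n) :
    HasDerivAt (fun t : ℝ => h (y + t • v) J) (fderiv ℝ G (y, J.mat) (v, 0)) 0 := by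
  have hGd : DifferentiableAt ℝ G (y, J.mat) :=
    ((hG.differentiableOn (by simp)) _ hyO).differentiableAt (hO.mem_nhds hyO)
  have hc : HasDerivAt (fun t : ℝ => (y + t • v, J.mat)) (v, 0) 0 := by
    refine HasDerivAt.prodMk ?_ (hasDerivAt_const _ _)
    simpa using ((hasDerivAt_id (0 : ℝ)).smul_const v).const_add y
  have h0 : ((y + (0 : ℝ) • v, J.mat) : E n × RMat n) = (y, J.mat) := by simp
  have hGd' := hGd.hasFDerivAt
  rw [← h0] at hGd'
  have h1 := hGd'.comp_hasDerivAt (0 : ℝ) hc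
  rw [h0] at h1
  refine h1.congr_of_eventuallyEq ?_
  have hcont : ContinuousAt (fun t : ℝ => ((y + t • v, J.mat) : E n × RMat n)) 0 :=
    hc.continuousAt
  have hn : (U ×ˢ Set.univ) ∩ O ∈ nhds ((y + (0 : ℝ) • v, J.mat) : E n × RMat n) := by
    rw [h0]
    exact ((hU.prod isOpen_univ).inter hO).mem_nhds ⟨⟨hy, trivial⟩, hyO⟩
  filter_upwards [hcont hn] with t ht
  exact hGh _ ht.1.1 J hJ ht.2

theorem SmoothFun.differentiableAt (hU : IsOpen U) {h : E n → OCS n → V} (hh : SmoothFun U ε h)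
    {x : E n} (hx : x ∈ U) {J : OCS n} (hJ : J ∈ Z n ε) (v : E n) :
    DifferentiableAt ℝ (fun t : ℝ => h (x + t • v) J) 0 := by
  obtain ⟨O, G, hO, hxO, hG, hGh⟩ := hh x hx J hJ
  exact (SmoothFun.hasDerivAt_aux hU hO hG hGh hx hJ hxO v).differentiableAt

theorem SmoothFun.hasDerivAt_fderiv (hU : IsOpen U) {h : E n → OCS n → V}
    (hh : SmoothFun U ε h) {x : E n} (hx : x ∈ U) {J : OCS n} (hJ : J ∈ Z n ε) :
    ∃ L : E n →L[ℝ] V, ∀ v, HasDerivAt (fun t : ℝ => h (x + t • v) J) (L v) 0 := by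
  obtain ⟨O, G, hO, hxO, hG, hGh⟩ := hh x hx J hJ
  exact ⟨(fderiv ℝ G (x, J.mat)).comp (ContinuousLinearMap.inl ℝ _ _),
    fun v => SmoothFun.hasDerivAt_aux hU hO hG hGh hx hJ hxO v⟩

theorem SmoothFun.deriv (hU : IsOpen U) {h : E n → OCS n → V} (hh : SmoothFun U ε h) (v : E n) :
    SmoothFun U ε (fun x J => deriv (fun t : ℝ => h (x + t • v) J) 0) := by
  intro x hx J hJ
  obtain ⟨O, G, hO, hxO, hG, hGh⟩ := hh x hx J hJ
  refine ⟨O, fun p => fderiv ℝ G p (v, 0), hO, hxO, ?_, fun y hy J' hJ' hO' =>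
    (SmoothFun.hasDerivAt_aux hU hO hG hGh hy hJ' hO' v).deriv⟩
  exact (hG.fderiv_of_isOpen hO (by simp)).clm_apply contDiffOn_const

end SmoothFun

/-- A vertical vector in terms of the fields induced by the `F_{pq}`. -/
theorem vert_eq_sum (J : OCS n) (B : Vert J) :
    B = ∑ p, ∑ q, ((-1 / 4 : ℂ) * (B.1 * J.cmat) q p) • fund (rot p q) J := by
  have h1 : B.1ᵀ = -B.1 := B.2.1
  have h2 : B.1 * J.cmat = -(J.cmat * B.1) := B.2.2
  have h3 : (B.1 * J.cmat)ᵀ = -(B.1 * J.cmat) := by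
    rw [Matrix.transpose_mul, h1, J.cmat_transpose, neg_mul_neg, h2, neg_neg]
  -- The element `-BJ/2` of `so(2n)` induces `B`. Summing over ordered pairs counts each rotation
  -- twice, hence `-1/4`.
  have h4 : ∑ p, ∑ q, ((-1 / 4 : ℂ) * (B.1 * J.cmat) q p) • (rot p q).1
      = (-1 / 2 : ℂ) • (B.1 * J.cmat) := by
    have h5 : ∀ i j, (B.1 * J.cmat) j i = -(B.1 * J.cmat) i j := fun i j =>
      congrFun (congrFun h3 i) j
    generalize B.1 * J.cmat = S at *
    ext i j
    simp only [rot, Matrix.sum_apply, Matrix.smul_apply, Matrix.sub_apply, Matrix.single_apply,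
      smul_eq_mul, mul_sub, Finset.sum_sub_distrib, ite_and]
    simp
    rw [h5 i j]
    ring
  ext1
  have h6 : ∀ p q, (((((-1 / 4 : ℂ) * (B.1 * J.cmat) q p) • fund (rot p q) J : Vert J)) : CMat n)
      = (((-1 / 4 : ℂ) * (B.1 * J.cmat) q p) • (rot p q).1) * J.cmat
        - J.cmat * (((-1 / 4 : ℂ) * (B.1 * J.cmat) q p) • (rot p q).1) := fun p q => by
    rw [Matrix.smul_mul, Matrix.mul_smul, ← smul_sub]; rfl
  simp only [AddSubmonoidClass.coe_finsetSum, h6, Finset.sum_sub_distrib]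
  simp only [← Matrix.sum_mul, ← Matrix.mul_sum]
  rw [h4]
  simp only [Matrix.smul_mul, Matrix.mul_smul]
  rw [← Matrix.mul_assoc J.cmat, ← neg_eq_iff_eq_neg.2 h2, Matrix.neg_mul, Matrix.mul_assoc,
    J.cmat_sq]
  ext i j
  simp
  ring

/-- The coefficients of `ℱ̄_{ab}`. -/
def FbarCoeff (a b p q : Idx n) (M : RMat n) : ℂ :=
  let C := M.map Complex.ofReal
  let A := (rot a b).1 * C - C * (rot a b).1
  (-1 / 4 : ℂ) * (((1 / 2 : ℂ) • (A + Complex.I • (C * A))) * C) q p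

/-- The coefficients are polynomial in the entries of `J`. -/
theorem contDiff_FbarCoeff (a b p q : Idx n) : ContDiff ℝ ∞ (FbarCoeff a b p q) := by
  have hM : ∀ i j, ContDiff ℝ ∞ (fun M : RMat n => (M i j : ℂ)) := fun i j =>
    Complex.ofRealCLM.contDiff.comp (contDiff_apply_apply ℝ ℝ i j)
  change ContDiff ℝ ∞ fun M => FbarCoeff a b p q M
  simp only [FbarCoeff, Matrix.mul_apply, Matrix.smul_apply, Matrix.add_apply, Matrix.sub_apply,
    Matrix.map_apply, smul_eq_mul]
  fun_prop

theorem Fbar_eq_sum (a b : Idx n) (J : OCS n) :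
    Fbar a b J = ∑ p, ∑ q, FbarCoeff a b p q J.mat • fund (rot p q) J :=
  vert_eq_sum J (Fbar a b J)

/-! ### Smoothness of `D η` -/

section IsSection

variable {U : Set (E n)} {ε : ℤˣ} {η : Field n k K}

theorem exists_eq_fund {J : OCS n} (u : Fin k → Tang J) :
    ∃ (v : Fin k → Idx n → ℂ) (c : Fin k → LieAlgebra.Orthogonal.so (Idx n) ℂ),
      u = fun i => (v i, fund (c i) J) := by
  choose c hc using fun i => exists_fund_eq J (u i).2
  exact ⟨fun i => (u i).1, c, by funext i; rw [hc]⟩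

theorem IsSection.horDiff (hU : IsOpen U) (hη : IsSection U ε η) {x : E n} (hx : x ∈ U)
    {J : OCS n} (hJ : J ∈ Z n ε) : HorDiff η x J := by
  intro a u
  obtain ⟨v, c, rfl⟩ := exists_eq_fund u
  exact (hη v c).differentiableAt hU hx hJ (e a)

/-- `IsSection` only tests arguments built from the fields `fund c`, so the new argument `nil J a (u
i)` is expanded in these. Linearity of `hderiv` in the slot comes from its being a value of the form
`lie a η x J`. -/
theorem HorDiff.hderiv_update_nil {x : E n} {J : OCS n} (h : HorDiff η x J) (a : Idx n)
    (u : Fin k → Tang J) (i : Fin k) :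
    hderiv a η x J (Function.update u i (nil J a (u i)))
      = ∑ b, ∑ p, ∑ q, ((u i).1 b * FbarCoeff a b p q J.mat) •
          hderiv a η x J (Function.update u i (0, fund (rot p q) J)) := by
  have h1 : nil J a (u i) = ∑ b, ∑ p, ∑ q, ((u i).1 b * FbarCoeff a b p q J.mat) •
      ((0, fund (rot p q) J) : Tang J) := by
    rw [nil_apply]
    simp only [Fbar_eq_sum, mul_smul, Finset.smul_sum]
    ext1
    · simp [Prod.fst_sum]
    · simp [Prod.snd_sum]
  let L : Tang J →ₗ[ℂ] TensorPow n K :=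
    (linePow K J).subtype ∘ₗ (lie a η x J).toMultilinearMap.toLinearMap u i
  have h2 : ∀ w : Tang J, hderiv a η x J (Function.update u i w) = L w := fun w =>
    (h.coe_lie_apply a _).symm
  simp only [h2]
  rw [h1]
  simp only [map_sum, map_smul]

theorem IsSection.D (hU : IsOpen U) (hη : IsSection U ε η) : IsSection U ε (D η) := by
  intro v c
  have h1 : SmoothFun U ε fun x J => ∑ i, ∑ a, ∑ b, ∑ p, ∑ q,
      (v i b * FbarCoeff a b p q J.mat) • hderiv a η x J
        (fun j => (Function.update v i 0 j, fund (Function.update c i (rot p q) j) J)) := by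
    refine smoothFun_sum _ fun i _ => smoothFun_sum _ fun a _ => smoothFun_sum _ fun b _ =>
      smoothFun_sum _ fun p _ => smoothFun_sum _ fun q _ => ?_
    exact SmoothFun.smul ((hη (Function.update v i 0) (Function.update c i (rot p q))).deriv hU (e a))
      (r := fun M => v i b * FbarCoeff a b p q M)
      (contDiff_const.mul (contDiff_FbarCoeff a b p q))
  refine h1.congr fun x hx J hJ => ?_
  have h := hη.horDiff hU hx hJ
  rw [h.D_apply]
  refine Finset.sum_congr rfl fun i _ => Finset.sum_congr rfl fun a _ => ?_
  rw [h.hderiv_update_nil]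
  refine Finset.sum_congr rfl fun b _ => Finset.sum_congr rfl fun p _ =>
    Finset.sum_congr rfl fun q _ => ?_
  congr 2
  funext j
  by_cases hj : j = i
  · subst hj; simp
  · simp [hj]

theorem IsSection.iterate_D (hU : IsOpen U) (hη : IsSection U ε η) (j : ℕ) :
    IsSection U ε (Twistor.D^[j] η) := by
  induction j with
  | zero => exact hη
  | succ j ih => rw [Function.iterate_succ_apply']; exact ih.D hU

theorem hderiv_eq_zero (hU : IsOpen U) {x : E n} (hx : x ∈ U) {J : OCS n} {a : Idx n}
    {u : Fin k → Tang J} (h : ∀ y ∈ U, η y J u = 0) : hderiv a η x J u = 0 := by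
  have hc : ContinuousAt (fun t : ℝ => x + t • e a) 0 := by fun_prop
  have hev : (fun t : ℝ => (η (x + t • e a) J u : TensorPow n K)) =ᶠ[nhds 0] fun _ => 0 := by
    filter_upwards [hc (hU.mem_nhds (by simpa using hx))] with t ht
    rw [h _ ht]; rfl
  rw [hderiv, hev.deriv_eq, deriv_const]

end IsSection

/-! ### Types -/

/-- Replacing an argument of type `(1,0)` gives zero; replacing one of type `(0,1)` gives another of
type `(0,1)`, so the set `s` stays the same and `η` vanishes on the new tuple at all nearby points.
-/
theorem IsTypeSection.D {U : Set (E n)} (hU : IsOpen U) {ε : ℤˣ} {l l' : ℕ}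
    {η : Field n (l + l') K} (hη : IsTypeSection U ε l l' η) : IsTypeSection U ε l l' (D η) := by
  refine ⟨hη.1.D hU, fun x hx J hJ u s hs hs' hsl => ?_⟩
  have h := hη.1.horDiff hU hx hJ
  refine Subtype.ext ?_
  rw [h.D_apply]
  refine Finset.sum_eq_zero fun i _ => Finset.sum_eq_zero fun a _ => ?_
  by_cases hi : i ∈ s
  · rw [nil_eq_zero_of_type J a (u i) (hs i hi), ← h.coe_lie_apply,
      ContinuousAlternatingMap.map_update_zero]
    rfl
  · refine hderiv_eq_zero hU hx fun y hy => hη.2 y hy J hJ _ s (fun j hj => ?_) (fun j hj => ?_) hsl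
    · rw [Function.update_of_ne (ne_of_mem_of_not_mem hj hi)]; exact hs j hj
    · by_cases hji : j = i
      · subst hji
        rw [Function.update_self]; exact tangJ_nil J a _
      · rw [Function.update_of_ne hji]; exact hs' j hj

/-! ### Nilpotency -/

/-- The set `s` contains every slot on which some `nil J a` may be nonzero. The outermost `D` either
gives zero or acts on a slot of `s`, which can then be removed from `s` because `nil` composed with
`nil` vanishes. -/
theorem iterate_D_apply_eq_zero {U : Set (E n)} (hU : IsOpen U) {ε : ℤˣ}
    {η : Field n k K} (hη : IsSection U ε η) {J : OCS n} (hJ : J ∈ Z n ε) (r : ℕ) :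
    ∀ (u : Fin k → Tang J) (s : Finset (Fin k)), (∀ i ∉ s, ∀ a, nil J a (u i) = 0) → s.card ≤ r →
      ∀ x ∈ U, (D^[r + 1] η) x J u = 0 := by
  induction r with
  | zero =>
    intro u s hs hr x hx
    have h := hη.horDiff hU hx hJ
    refine Subtype.ext ?_
    rw [zero_add, Function.iterate_one, h.D_apply]
    refine Finset.sum_eq_zero fun i _ => Finset.sum_eq_zero fun a _ => ?_
    have hi : i ∉ s := by
      rw [Finset.card_eq_zero.1 (Nat.le_zero.1 hr)]; exact Finset.notMem_empty i
    rw [hs i hi, ← h.coe_lie_apply, ContinuousAlternatingMap.map_update_zero]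
    rfl
  | succ r ih =>
    intro u s hs hr x hx
    have h := (hη.iterate_D hU (r + 1)).horDiff hU hx hJ
    refine Subtype.ext ?_
    rw [Function.iterate_succ_apply', h.D_apply]
    refine Finset.sum_eq_zero fun i _ => Finset.sum_eq_zero fun a _ => ?_
    by_cases hi : i ∈ s
    · refine hderiv_eq_zero hU hx fun y hy => ih _ (s.erase i) (fun j hj b => ?_) ?_ y hy
      · by_cases hji : j = i
        · subst hji
          rw [Function.update_self, nil_nil]
        · rw [Function.update_of_ne hji]
          exact hs j (fun hjs => hj (Finset.mem_erase.2 ⟨hji, hjs⟩)) b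
      · rw [Finset.card_erase_of_mem hi]; omega
    · rw [hs i hi, ← h.coe_lie_apply, ContinuousAlternatingMap.map_update_zero]
      rfl

/-- A basis adapted to the kernel of a linear map of rank `r`. -/
theorem exists_basis_of_finrank_range {V W : Type} [AddCommGroup V] [Module ℂ V]
    [FiniteDimensional ℂ V] [AddCommGroup W] [Module ℂ W] (q : V →ₗ[ℂ] W) {r : ℕ}
    (hr : Module.finrank ℂ (LinearMap.range q) = r) :
    ∃ (κ : Type) (_ : Fintype κ) (b : Module.Basis (κ ⊕ Fin r) ℂ V), ∀ i, q (b (Sum.inl i)) = 0 := by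
  obtain ⟨C, hC⟩ := (LinearMap.ker q).exists_isCompl
  have hCn : Module.finrank ℂ C = r := by
    have h1 := Submodule.finrank_add_eq_of_isCompl hC
    have h2 := q.finrank_range_add_finrank_ker
    omega
  let b1 := Module.finBasis ℂ (LinearMap.ker q)
  let b2 : Module.Basis (Fin r) ℂ C := Module.finBasisOfFinrankEq ℂ C hCn
  refine ⟨_, inferInstance, (b1.prod b2).map (Submodule.prodEquivOfIsCompl _ _ hC), fun i => ?_⟩
  have h3 : ((b1.prod b2).map (Submodule.prodEquivOfIsCompl _ _ hC)) (Sum.inl i) = (b1 i : V) := by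
    simp
  rw [h3]
  exact (b1 i).2

/-- A basis of the tangent space, all but `n` of whose elements have a horizontal part of
type `(1,0)`. -/
theorem exists_basis (J : OCS n) :
    ∃ (κ : Type) (_ : Fintype κ) (b : Module.Basis (κ ⊕ Fin n) ℂ (Tang J)),
      ∀ i, projBar J *ᵥ (b (Sum.inl i)).1 = 0 := by
  refine exists_basis_of_finrank_range
    (Matrix.toLin' (projBar J) ∘ₗ LinearMap.fst ℂ (Idx n → ℂ) (Vert J)) ?_
  rw [LinearMap.range_comp_of_range_eq_top _ (LinearMap.range_eq_top.2 LinearMap.fst_surjective)]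
  exact finrank_range_projBar J

/-- An alternating form is determined by its values on injective tuples of basis vectors. In the
adapted basis such a tuple has at most `n` entries not killed by `nil`. -/
theorem iterate_D_eq_zero {U : Set (E n)} (hU : IsOpen U) {ε : ℤˣ}
    {η : Field n k K} (hη : IsSection U ε η) {x : E n} (hx : x ∈ U) {J : OCS n}
    (hJ : J ∈ Z n ε) : (D^[n + 1] η) x J = 0 := by
  obtain ⟨κ, _, b, hb⟩ := exists_basis J
  have h : ((D^[n + 1] η) x J).toAlternatingMap = 0 := by
    refine Module.Basis.ext_alternating b fun w hw => ?_
    refine iterate_D_apply_eq_zero hU hη hJ n (fun i => b (w i))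
      (Finset.univ.filter fun i => (w i).isRight) (fun i hi a => ?_) ?_ x hx
    · obtain ⟨j, hj⟩ : ∃ j, w i = Sum.inl j := by
        cases hwi : w i with
        | inl j => exact ⟨j, rfl⟩
        | inr j => simp [hwi] at hi
      refine nil_eq_zero J a _ ?_
      simp only [hj]
      exact hb j
    · have h1 : ((Finset.univ.filter fun i => (w i).isRight).map ⟨w, hw⟩)
          ⊆ Finset.univ.map Function.Embedding.inr := by
        intro z hz
        obtain ⟨i, hi, rfl⟩ := Finset.mem_map.1 hz
        cases hwi : w i with
        | inl j => simp [hwi] at hi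
        | inr j => simp [hwi]
      simpa using Finset.card_le_card h1
  refine ContinuousAlternatingMap.ext fun u => ?_
  exact congrArg (fun m : Tang J [⋀^Fin k]→ₗ[ℂ] linePow K J => m u) h

theorem iterate_D_eq_zero_of_le {U : Set (E n)} (hU : IsOpen U) {ε : ℤˣ}
    {η : Field n k K} (hη : IsSection U ε η) {x : E n} (hx : x ∈ U) {J : OCS n}
    (hJ : J ∈ Z n ε) {j : ℕ} (hj : n + 1 ≤ j) : (D^[j] η) x J = 0 := by
  obtain ⟨i, rfl⟩ := Nat.exists_eq_add_of_le hj
  rw [Function.iterate_add_apply]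
  exact iterate_D_eq_zero hU (hη.iterate_D hU i) hx hJ

theorem hasSum_iterate_D {U : Set (E n)} (hU : IsOpen U) {ε : ℤˣ}
    {η : Field n k K} (hη : IsSection U ε η) {x : E n} (hx : x ∈ U) {J : OCS n}
    (hJ : J ∈ Z n ε) (s : PowerSeries ℂ) :
    HasSum (fun j => PowerSeries.coeff j s • (D^[j] η) x J)
      (∑ j ∈ Finset.range (n + 1), PowerSeries.coeff j s • (D^[j] η) x J) := by
  refine hasSum_sum_of_ne_finset_zero fun j hj => ?_
  rw [iterate_D_eq_zero_of_le hU hη hx hJ (by simpa using hj)]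
  exact ContinuousAlternatingMap.ext fun u => smul_zero (PowerSeries.coeff j s)

end Twistor

end

noncomputable section

namespace Twistor

/-! ### Liouville's theorem for global conformal maps -/

section Liouville

variable {V W : Type*} [NormedAddCommGroup V] [NormedAddCommGroup W]

/-- The directional derivative. -/
def dirDeriv [NormedSpace ℝ V] [NormedSpace ℝ W] (v : V) (g : V → W) : V → W :=
  fun x => fderiv ℝ g x v

section NormedSpace

variable [NormedSpace ℝ V] [NormedSpace ℝ W] {g : V → W}

theorem _root_.ContDiff.dirDeriv (hg : ContDiff ℝ ∞ g) (v : V) : ContDiff ℝ ∞ (dirDeriv v g) :=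
  (hg.fderiv_right (m := ∞) (by simp)).clm_apply contDiff_const

theorem dirDeriv_comm (hg : ContDiff ℝ ∞ g) (u v : V) :
    dirDeriv u (dirDeriv v g) = dirDeriv v (dirDeriv u g) := by
  have h : ∀ u v x, dirDeriv u (dirDeriv v g) x = fderiv ℝ (fderiv ℝ g) x u v := by
    intro u v x
    have h1 : DifferentiableAt ℝ (fderiv ℝ g) x :=
      ((hg.fderiv_right (m := ∞) (by simp)).differentiable (by simp)) x
    have h2 : dirDeriv v g = fun y => fderiv ℝ g y v := rfl
    rw [dirDeriv, h2, fderiv_clm_apply h1 (differentiableAt_const _)]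
    simp
  funext x
  rw [h, h]
  exact (hg.contDiffAt.isSymmSndFDerivAt (by
    simpa using (WithTop.coe_le_coe.2 (le_top : (2 : ℕ∞) ≤ ⊤)))) u v

theorem dirDeriv_add_left (u v : V) (g : V → W) :
    dirDeriv (u + v) g = dirDeriv u g + dirDeriv v g := by
  funext x; simp [dirDeriv]

theorem dirDeriv_sub_left (u v : V) (g : V → W) :
    dirDeriv (u - v) g = dirDeriv u g - dirDeriv v g := by
  funext x; simp [dirDeriv]

theorem dirDeriv_smul_left (c : ℝ) (v : V) (g : V → W) :
    dirDeriv (c • v) g = c • dirDeriv v g := by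
  funext x; simp [dirDeriv]

theorem dirDeriv_add {g' : V → W} (hg : ContDiff ℝ ∞ g) (hg' : ContDiff ℝ ∞ g') (v : V) :
    dirDeriv v (g + g') = dirDeriv v g + dirDeriv v g' := by
  funext x
  simp only [dirDeriv, Pi.add_apply]
  rw [fderiv_add (hg.differentiable (by simp) x) (hg'.differentiable (by simp) x)]
  rfl

theorem dirDeriv_sub {g' : V → W} (hg : ContDiff ℝ ∞ g) (hg' : ContDiff ℝ ∞ g') (v : V) :
    dirDeriv v (g - g') = dirDeriv v g - dirDeriv v g' := by
  funext x
  simp only [dirDeriv, Pi.sub_apply]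
  rw [fderiv_sub (hg.differentiable (by simp) x) (hg'.differentiable (by simp) x)]
  rfl

theorem dirDeriv_const_smul (hg : ContDiff ℝ ∞ g) (c : ℝ) (v : V) :
    dirDeriv v (c • g) = c • dirDeriv v g := by
  funext x
  simp only [dirDeriv, Pi.smul_apply]
  rw [fderiv_const_smul (hg.differentiable (by simp) x)]
  rfl

theorem dirDeriv_smul {r : V → ℝ} (hr : ContDiff ℝ ∞ r) (hg : ContDiff ℝ ∞ g) (v : V) :
    dirDeriv v (r • g) = dirDeriv v r • g + r • dirDeriv v g := by
  funext x
  have h := ((hr.differentiable (by simp) x).hasFDerivAt.smul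
    (hg.differentiable (by simp) x).hasFDerivAt).fderiv
  have h2 : fderiv ℝ (r • g) x v = r x • fderiv ℝ g x v + fderiv ℝ r x v • g x := by
    rw [h]; simp
  simp only [dirDeriv, Pi.add_apply, Pi.smul_apply', h2, add_comm]

theorem eq_of_dirDeriv_eq_zero (hg : ContDiff ℝ ∞ g) (h : ∀ v, dirDeriv v g = 0) (x y : V) :
    g x = g y :=
  is_const_of_fderiv_eq_zero (𝕜 := ℝ) (hg.differentiable (by simp))
    (fun x => by ext v; exact congrFun (h v) x) x y

end NormedSpace

/-! ### Differential identities for a conformal map and its factor -/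

variable [InnerProductSpace ℝ V]

open scoped RealInnerProductSpace

/-- `f` is smooth and conformal with the squared conformal factor `s`. -/
structure ConformalData (f : V → V) (s : V → ℝ) : Prop where
  smooth : ContDiff ℝ ∞ f
  smooth_factor : ContDiff ℝ ∞ s
  pos : ∀ x, 0 < s x
  inner_eq : ∀ u v x, ⟪dirDeriv u f x, dirDeriv v f x⟫ = s x * ⟪u, v⟫

theorem exists_conformalData [Nontrivial V] {f : V → V} (hf : ContDiff ℝ ∞ f)
    (hc : Conformal f) : ∃ s, ConformalData f s := by
  obtain ⟨e, he⟩ := exists_norm_eq V (zero_le_one (α := ℝ))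
  have h1 : ∀ x, ∃ c : ℝ, 0 < c ∧ ∀ u v, ⟪dirDeriv u f x, dirDeriv v f x⟫ = c * ⟪u, v⟫ := fun x =>
    (conformalAt_iff (hf.differentiable (by simp) x).hasFDerivAt).1 (hc.conformalAt x)
  have h2 : ∀ x, ∀ c : ℝ, (∀ u v, ⟪dirDeriv u f x, dirDeriv v f x⟫ = c * ⟪u, v⟫) →
      ⟪dirDeriv e f x, dirDeriv e f x⟫ = c := fun x c h => by
    rw [h, real_inner_self_eq_norm_sq, he]; simp
  -- Reading the factor off one fixed unit direction makes its smoothness evident.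
  refine ⟨fun x => ⟪dirDeriv e f x, dirDeriv e f x⟫, hf,
    (hf.dirDeriv e).inner ℝ (hf.dirDeriv e), fun x => ?_, fun u v x => ?_⟩
  · obtain ⟨c, hc0, hc⟩ := h1 x
    rw [h2 x c hc]; exact hc0
  · obtain ⟨c, hc0, hc⟩ := h1 x
    simp only [h2 x c hc, hc]

namespace ConformalData

variable {f : V → V} {s : V → ℝ}

theorem norm_dirDeriv (h : ConformalData f s) (v x : V) : ‖dirDeriv v f x‖ = √(s x) * ‖v‖ := by
  have h1 := h.inner_eq v v x
  rw [real_inner_self_eq_norm_sq, real_inner_self_eq_norm_sq] at h1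
  rw [← Real.sqrt_sq (norm_nonneg (dirDeriv v f x)), h1, Real.sqrt_mul (h.pos x).le,
    Real.sqrt_sq (norm_nonneg v)]

theorem eq_zero_of_inner_dirDeriv [FiniteDimensional ℝ V] (h : ConformalData f s) {x z : V} (hz : ∀ w, ⟪z, dirDeriv w f x⟫ = 0) : z = 0 := by
  have hinj : Function.Injective (fderiv ℝ f x : V →ₗ[ℝ] V) := by
    rw [← LinearMap.ker_eq_bot, LinearMap.ker_eq_bot']
    intro v hv
    have h1 : ‖dirDeriv v f x‖ = 0 := by
      rw [norm_eq_zero]; exact hv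
    rw [h.norm_dirDeriv, mul_eq_zero, norm_eq_zero] at h1
    exact h1.resolve_left (Real.sqrt_pos.2 (h.pos x)).ne'
  obtain ⟨w, hw⟩ := LinearMap.surjective_of_injective hinj z
  have h1 := hz w
  rw [show dirDeriv w f x = z from hw] at h1
  exact inner_self_eq_zero.1 h1

/-- The Koszul argument: differentiate `inner_eq` with the three vectors in cyclic order, and
combine using the symmetry of second derivatives. -/
theorem inner_dirDeriv_dirDeriv (h : ConformalData f s) (u v w x : V) :
    2 * ⟪dirDeriv v (dirDeriv u f) x, dirDeriv w f x⟫
      = dirDeriv u s x * ⟪v, w⟫ + dirDeriv v s x * ⟪u, w⟫ - dirDeriv w s x * ⟪u, v⟫ := by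
  have key : ∀ u v w, ⟪dirDeriv w (dirDeriv u f) x, dirDeriv v f x⟫
      + ⟪dirDeriv u f x, dirDeriv w (dirDeriv v f) x⟫ = dirDeriv w s x * ⟪u, v⟫ := by
    intro u v w
    have h1 : dirDeriv w (fun y => ⟪dirDeriv u f y, dirDeriv v f y⟫) x
        = ⟪dirDeriv u f x, dirDeriv w (dirDeriv v f) x⟫
          + ⟪dirDeriv w (dirDeriv u f) x, dirDeriv v f x⟫ :=
      fderiv_inner_apply ℝ ((h.smooth.dirDeriv u).differentiable (by simp) x)
        ((h.smooth.dirDeriv v).differentiable (by simp) x) w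
    have h2 : dirDeriv w (fun y => ⟪dirDeriv u f y, dirDeriv v f y⟫) x
        = dirDeriv w s x * ⟪u, v⟫ := by
      simp only [h.inner_eq]
      rw [dirDeriv, fderiv_mul_const (h.smooth_factor.differentiable (by simp) x)]
      simp [dirDeriv, mul_comm]
    rw [← h2, h1, add_comm]
  have k1 := key u v w
  have k2 := key v w u
  have k3 := key w u v
  rw [dirDeriv_comm h.smooth u v, dirDeriv_comm h.smooth u w] at k2
  rw [dirDeriv_comm h.smooth v w] at k3
  rw [real_inner_comm u w] at k3
  have c1 := real_inner_comm (dirDeriv v f x) (dirDeriv w (dirDeriv u f) x)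
  have c2 := real_inner_comm (dirDeriv w f x) (dirDeriv v (dirDeriv u f) x)
  have c3 := real_inner_comm (dirDeriv u f x) (dirDeriv w (dirDeriv v f) x)
  linarith

end ConformalData

/-- The inverse of the conformal factor. -/
def invFactor (s : V → ℝ) : V → ℝ := fun x => (√(s x))⁻¹

namespace ConformalData

variable {f : V → V} {s : V → ℝ}

theorem contDiff_invFactor (h : ConformalData f s) : ContDiff ℝ ∞ (invFactor s) :=
  (h.smooth_factor.sqrt fun x => (h.pos x).ne').inv fun x => (Real.sqrt_pos.2 (h.pos x)).ne'

theorem invFactor_pos (h : ConformalData f s) (x : V) : 0 < invFactor s x :=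
  inv_pos.2 (Real.sqrt_pos.2 (h.pos x))

theorem invFactor_mul (h : ConformalData f s) (x : V) :
    invFactor s x * (invFactor s x * s x) = 1 := by
  have h1 := Real.sqrt_pos.2 (h.pos x)
  have h2 := Real.mul_self_sqrt (h.pos x).le
  rw [invFactor]
  nth_rewrite 3 [← h2]
  field_simp

/-- Differentiate `r² s = 1` with `r = invFactor s`, and divide by `r`. -/
theorem invFactor_mul_dirDeriv (h : ConformalData f s) (u x : V) :
    invFactor s x * dirDeriv u s x = -2 * s x * dirDeriv u (invFactor s) x := by
  have hr := h.contDiff_invFactor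
  have h1 : invFactor s • (invFactor s • s) = fun _ => (1 : ℝ) := funext h.invFactor_mul
  have h2 : dirDeriv u (invFactor s • (invFactor s • s)) x = 0 := by
    rw [h1]; simp [dirDeriv]
  rw [dirDeriv_smul hr (hr.smul h.smooth_factor), dirDeriv_smul hr h.smooth_factor] at h2
  simp only [Pi.add_apply, Pi.mul_apply, smul_eq_mul] at h2
  have h3 : invFactor s x * (invFactor s x * dirDeriv u s x
      + 2 * s x * dirDeriv u (invFactor s) x) = 0 := by linarith
  have h4 := (mul_eq_zero.1 h3).resolve_left (h.invFactor_pos x).ne'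
  linarith

theorem norm_dirDeriv_eq (h : ConformalData f s) (v x : V) :
    ‖dirDeriv v f x‖ = (invFactor s x)⁻¹ * ‖v‖ := by
  rw [h.norm_dirDeriv, invFactor, inv_inv]

/-- If the inverse of the conformal factor grows quadratically, then `f` is bounded. -/
theorem norm_sub_le_of_quadratic_bound (h : ConformalData f s) {x₀ : V} {M : ℝ}
    (hM : ∀ x, (invFactor s (x₀ + x))⁻¹ ≤ M * (1 / (1 + ‖x‖ ^ 2))) (hM0 : 0 ≤ M) (x : V) :
    ‖f (x₀ + x) - f x₀‖ ≤ M * (Real.pi / 2) := by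
  by_cases hx : x = 0
  · subst hx
    simp
    positivity
  have hx0 : ‖x‖ ≠ 0 := norm_ne_zero_iff.2 hx
  set v := ‖x‖⁻¹ • x with hv
  have hv1 : ‖v‖ = 1 := by rw [hv, norm_smul, norm_inv, norm_norm, inv_mul_cancel₀ hx0]
  have hxv : ‖x‖ • v = x := by rw [hv, smul_smul, mul_inv_cancel₀ hx0, one_smul]
  have hd : ∀ t : ℝ, HasDerivAt (fun t : ℝ => f (x₀ + t • v) - f x₀)
      (dirDeriv v f (x₀ + t • v)) t := by
    intro t
    have h1 : HasDerivAt (fun t : ℝ => x₀ + t • v) v t := by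
      simpa using ((hasDerivAt_id t).smul_const v).const_add x₀
    exact ((h.smooth.differentiable (by simp) (x₀ + t • v)).hasFDerivAt.comp_hasDerivAt t
      h1).sub_const _
  have hB : ∀ t : ℝ, HasDerivAt (fun t : ℝ => M * Real.arctan t) (M * (1 / (1 + t ^ 2))) t :=
    fun t => (Real.hasDerivAt_arctan t).const_mul M
  -- Along the ray from `x₀` the speed is at most `M / (1 + t²)`, the derivative of `M * arctan t`.
  have h2 := image_norm_le_of_norm_deriv_right_le_deriv_boundary
    (a := 0) (b := ‖x‖) (fun t _ => (hd t).continuousAt.continuousWithinAt)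
    (fun t _ => (hd t).hasDerivWithinAt) (by simp) hB (fun t _ => by
      rw [h.norm_dirDeriv_eq, hv1, mul_one]
      refine (hM (t • v)).trans_eq ?_
      rw [norm_smul, hv1, mul_one, Real.norm_eq_abs, sq_abs])
    (Set.right_mem_Icc.2 (norm_nonneg x))
  simp only [hxv] at h2
  exact h2.trans (mul_le_mul_of_nonneg_left (Real.arctan_lt_pi_div_two _).le hM0)

/-! ### Liouville's theorem through the Hessian of the inverse factor -/

variable [FiniteDimensional ℝ V]

theorem smul_dirDeriv_dirDeriv (h : ConformalData f s) {u v : V} (huv : ⟪u, v⟫ = 0) (x : V) :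
    invFactor s x • dirDeriv v (dirDeriv u f) x + dirDeriv u (invFactor s) x • dirDeriv v f x
      + dirDeriv v (invFactor s) x • dirDeriv u f x = 0 := by
  refine h.eq_zero_of_inner_dirDeriv (x := x) fun w => ?_
  have h1 := h.inner_dirDeriv_dirDeriv u v w x
  have hu := h.invFactor_mul_dirDeriv u x
  have hv := h.invFactor_mul_dirDeriv v x
  simp only [inner_add_left, real_inner_smul_left, h.inner_eq, huv] at h1 ⊢
  linear_combination (invFactor s x / 2) * h1 + ⟪v, w⟫ / 2 * hu + ⟪u, w⟫ / 2 * hv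

/-- With `r = invFactor s`, the remaining terms of the Leibniz rule are `r f_uv + r_u f_v + r_v
f_u`, which vanish for orthogonal directions. -/
theorem dirDeriv_dirDeriv_smul (h : ConformalData f s) {u v : V} (huv : ⟪u, v⟫ = 0) :
    dirDeriv v (dirDeriv u (invFactor s • f)) = dirDeriv v (dirDeriv u (invFactor s)) • f := by
  have hr := h.contDiff_invFactor
  rw [dirDeriv_smul hr h.smooth, dirDeriv_add ((hr.dirDeriv u).smul h.smooth)
    (hr.smul (h.smooth.dirDeriv u)), dirDeriv_smul (hr.dirDeriv u) h.smooth,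
    dirDeriv_smul hr (h.smooth.dirDeriv u)]
  funext x
  have h1 := h.smul_dirDeriv_dirDeriv huv x
  simp only [Pi.add_apply, Pi.smul_apply'] at h1 ⊢
  rw [add_assoc, add_eq_left, ← h1]
  abel

/-- Computing `∂_w ∂_v ∂_u (r f)` in two orders gives `r_uv f_w = r_uw f_v`. As `f_v` and `f_w` are
orthogonal, `r_uv = 0`. The third direction `w` is what requires dimension at least three. -/
theorem hessian_invFactor_aux (h : ConformalData f s) {u v w : V} (huv : ⟪u, v⟫ = 0)
    (huw : ⟪u, w⟫ = 0) (hvw : ⟪v, w⟫ = 0) (hw : w ≠ 0) (x : V) :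
    dirDeriv v (dirDeriv u (invFactor s)) x = 0 := by
  have hr := h.contDiff_invFactor
  have h1 : dirDeriv w (dirDeriv v (dirDeriv u (invFactor s • f))) x
      = dirDeriv v (dirDeriv w (dirDeriv u (invFactor s • f))) x := by
    rw [dirDeriv_comm ((hr.smul h.smooth).dirDeriv u)]
  rw [h.dirDeriv_dirDeriv_smul huv, h.dirDeriv_dirDeriv_smul huw,
    dirDeriv_smul ((hr.dirDeriv u).dirDeriv v) h.smooth,
    dirDeriv_smul ((hr.dirDeriv u).dirDeriv w) h.smooth,
    dirDeriv_comm (hr.dirDeriv u) w v] at h1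
  simp only [Pi.add_apply, Pi.smul_apply', add_right_inj] at h1
  have h2 := congrArg (fun z => ⟪z, dirDeriv w f x⟫) h1
  simp only [real_inner_smul_left, h.inner_eq, hvw, mul_zero, mul_eq_zero,
    inner_self_eq_zero, hw, or_false, (h.pos x).ne'] at h2
  exact h2

theorem _root_.Twistor.exists_orthogonal_pair (hV : 3 ≤ Module.finrank ℝ V) (u v : V) :
    ∃ w : V, w ≠ 0 ∧ ⟪u, w⟫ = 0 ∧ ⟪v, w⟫ = 0 := by
  classical
  let S : Submodule ℝ V := Submodule.span ℝ (({u, v} : Finset V) : Set V)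
  have h1 : Module.finrank ℝ S ≤ 2 :=
    (finrank_span_finset_le_card _).trans Finset.card_le_two
  have h2 := S.finrank_add_finrank_orthogonal
  have h3 : Sᗮ ≠ ⊥ := by
    intro h0
    rw [h0, finrank_bot] at h2
    omega
  obtain ⟨w, hw, hw0⟩ := Submodule.exists_mem_ne_zero_of_ne_bot h3
  rw [Submodule.mem_orthogonal] at hw
  exact ⟨w, hw0, hw u (Submodule.subset_span (by simp)), hw v (Submodule.subset_span (by simp))⟩

theorem hessian_invFactor_of_orthogonal (h : ConformalData f s) (hV : 3 ≤ Module.finrank ℝ V)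
    {u v : V} (huv : ⟪u, v⟫ = 0) : dirDeriv v (dirDeriv u (invFactor s)) = 0 := by
  obtain ⟨w, hw, huw, hvw⟩ := exists_orthogonal_pair hV u v
  exact funext fun x => h.hessian_invFactor_aux huv huw hvw hw x

theorem hessian_invFactor_eq_of_norm_eq (h : ConformalData f s) (hV : 3 ≤ Module.finrank ℝ V)
    {u v : V} (huv : ‖u‖ = ‖v‖) :
    dirDeriv u (dirDeriv u (invFactor s)) = dirDeriv v (dirDeriv v (invFactor s)) := by
  have hr := h.contDiff_invFactor
  -- Vectors of equal length have orthogonal sum and difference, and the mixed Hessian on this pair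
  -- is the difference of the two pure ones.
  have h1 : ⟪u + v, u - v⟫ = 0 := (real_inner_add_sub_eq_zero_iff u v).2 huv
  have h2 := h.hessian_invFactor_of_orthogonal hV h1
  rw [dirDeriv_add_left, dirDeriv_sub_left, dirDeriv_add (hr.dirDeriv u) (hr.dirDeriv v),
    dirDeriv_add (hr.dirDeriv u) (hr.dirDeriv v), dirDeriv_comm hr v u] at h2
  rw [← sub_eq_zero, ← h2]
  abel

theorem exists_hessian_invFactor (h : ConformalData f s) (hV : 3 ≤ Module.finrank ℝ V) :
    ∃ c : ℝ, ∀ u v x, dirDeriv v (dirDeriv u (invFactor s)) x = c * ⟪u, v⟫ := by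
  have hr := h.contDiff_invFactor
  have : Nontrivial V := Module.nontrivial_of_finrank_pos (R := ℝ) (by omega)
  obtain ⟨e, he⟩ := exists_norm_eq V (zero_le_one (α := ℝ))
  have hunit : ∀ u x : V, dirDeriv u (dirDeriv u (invFactor s)) x
      = ‖u‖ ^ 2 * dirDeriv e (dirDeriv e (invFactor s)) x := by
    intro u x
    have h1 : ‖u‖ = ‖‖u‖ • e‖ := by rw [norm_smul, he, norm_norm, mul_one]
    rw [h.hessian_invFactor_eq_of_norm_eq hV h1, dirDeriv_smul_left, dirDeriv_smul_left,
      dirDeriv_const_smul (hr.dirDeriv e)]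
    simp only [Pi.smul_apply, smul_eq_mul]
    ring
  have hconst : ∀ x, dirDeriv e (dirDeriv e (invFactor s)) x
      = dirDeriv e (dirDeriv e (invFactor s)) 0 := by
    intro x
    refine eq_of_dirDeriv_eq_zero ((hr.dirDeriv e).dirDeriv e) (fun w => ?_) x 0
    -- The pure second derivative may be taken along a unit vector orthogonal to `w`; its derivative
    -- along `w` is then a derivative of a vanishing mixed Hessian.
    obtain ⟨z, hz, hwz, -⟩ := exists_orthogonal_pair hV w w
    have h1 : ‖‖z‖⁻¹ • z‖ = ‖e‖ := by rw [he, norm_smul, norm_inv, norm_norm, inv_mul_cancel₀ (norm_ne_zero_iff.2 hz)]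
    have h2 : ⟪‖z‖⁻¹ • z, w⟫ = 0 := by rw [real_inner_smul_left, real_inner_comm, hwz, mul_zero]
    rw [← h.hessian_invFactor_eq_of_norm_eq hV h1, dirDeriv_comm (hr.dirDeriv _),
      h.hessian_invFactor_of_orthogonal hV h2]
    funext y
    simp [dirDeriv]
  refine ⟨dirDeriv e (dirDeriv e (invFactor s)) 0, fun u v x => ?_⟩
  by_cases hu : u = 0
  · subst hu
    have h1 : dirDeriv (0 : V) (invFactor s) = 0 := by funext y; simp [dirDeriv]
    rw [h1]; simp [dirDeriv]
  have hu2 : ‖u‖ ^ 2 ≠ 0 := by positivity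
  set z := v - (⟪u, v⟫ / ‖u‖ ^ 2) • u with hz
  have huz : ⟪u, z⟫ = 0 := by
    rw [hz, inner_sub_right, real_inner_smul_right, real_inner_self_eq_norm_sq]
    field_simp
    ring
  have hv : v = (⟪u, v⟫ / ‖u‖ ^ 2) • u + z := by rw [hz]; abel
  have h1 : dirDeriv v (dirDeriv u (invFactor s)) x
      = (⟪u, v⟫ / ‖u‖ ^ 2) * dirDeriv u (dirDeriv u (invFactor s)) x := by
    conv_lhs => rw [hv, dirDeriv_add_left, dirDeriv_smul_left,
      h.hessian_invFactor_of_orthogonal hV huz]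
    simp
  rw [h1, hunit u, hconst]
  field_simp

theorem exists_invFactor_eq (h : ConformalData f s) (hV : 3 ≤ Module.finrank ℝ V) :
    ∃ (c : ℝ) (a : V), ∀ x, invFactor s x = invFactor s 0 + ⟪a, x⟫ + c / 2 * ‖x‖ ^ 2 := by
  have hr := h.contDiff_invFactor
  obtain ⟨c, hc⟩ := h.exists_hessian_invFactor hV
  have h1 : ∀ u x, dirDeriv u (invFactor s) x = dirDeriv u (invFactor s) 0 + c * ⟪u, x⟫ := by
    intro u x
    have hl : ContDiff ℝ ∞ fun x : V => c * ⟪u, x⟫ :=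
      contDiff_const.mul (contDiff_const.inner ℝ contDiff_id)
    have h2 := eq_of_dirDeriv_eq_zero (g := dirDeriv u (invFactor s) - fun x : V => c * ⟪u, x⟫)
      ((hr.dirDeriv u).sub hl) (fun v => ?_) x 0
    · simp only [Pi.sub_apply, inner_zero_right, mul_zero, sub_zero] at h2
      linarith
    · rw [dirDeriv_sub (hr.dirDeriv u) hl]
      funext y
      have h3 : dirDeriv v (fun x : V => c * ⟪u, x⟫) y = c * ⟪u, v⟫ := by
        have := ((innerSL ℝ u).hasFDerivAt (x := y)).const_mul c
        rw [dirDeriv, HasFDerivAt.fderiv (f := fun x : V => c * ⟪u, x⟫) this]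
        simp
      simp only [Pi.sub_apply, hc, h3, sub_self, Pi.zero_apply]
  refine ⟨c, (InnerProductSpace.toDual ℝ V).symm (fderiv ℝ (invFactor s) 0), fun x => ?_⟩
  have hq : ContDiff ℝ ∞ fun x : V => fderiv ℝ (invFactor s) 0 x + c / 2 * ‖x‖ ^ 2 :=
    (ContinuousLinearMap.contDiff _).add (contDiff_const.mul (contDiff_norm_sq ℝ))
  have h2 := eq_of_dirDeriv_eq_zero
    (g := invFactor s - fun x : V => fderiv ℝ (invFactor s) 0 x + c / 2 * ‖x‖ ^ 2)
    (hr.sub hq) (fun v => ?_) x 0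
  · simp only [Pi.sub_apply, map_zero, norm_zero] at h2
    rw [InnerProductSpace.toDual_symm_apply]
    linarith
  · rw [dirDeriv_sub hr hq]
    funext y
    have h3 : dirDeriv v (fun x : V => fderiv ℝ (invFactor s) 0 x + c / 2 * ‖x‖ ^ 2) y
        = fderiv ℝ (invFactor s) 0 v + c * ⟪v, y⟫ := by
      have := ((fderiv ℝ (invFactor s) 0).hasFDerivAt (x := y)).add
        ((hasStrictFDerivAt_norm_sq y).hasFDerivAt.const_mul (c / 2))
      rw [dirDeriv, HasFDerivAt.fderiv
        (f := fun x : V => fderiv ℝ (invFactor s) 0 x + c / 2 * ‖x‖ ^ 2) this, real_inner_comm]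
      simp
      ring
    rw [Pi.sub_apply, h3, h1 v y]
    simp [dirDeriv]

/-- The conformal factor of a surjective conformal map is constant. -/
theorem invFactor_eq_of_surjective (h : ConformalData f s) (hV : 3 ≤ Module.finrank ℝ V)
    (hf : Function.Surjective f) (x : V) : invFactor s x = invFactor s 0 := by
  have : Nontrivial V := Module.nontrivial_of_finrank_pos (R := ℝ) (by omega)
  obtain ⟨c, a, hca⟩ := h.exists_invFactor_eq hV
  have hpos := h.invFactor_pos
  set d := invFactor s 0 with hd
  rcases lt_trichotomy c 0 with hc | hc | hc
  · exfalso
    -- For this norm the values at `y` and `-y` sum to zero, since the linear terms cancel; both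
    -- should be positive.
    obtain ⟨y, hy⟩ := exists_norm_eq V (Real.sqrt_nonneg (2 * d / (-c)))
    have h1 := hpos y
    have h2 := hpos (-y)
    rw [hca, norm_neg, inner_neg_right] at h2
    rw [hca] at h1
    have h3 : ‖y‖ ^ 2 = 2 * d / (-c) := by
      rw [hy, Real.sq_sqrt]
      exact div_nonneg (by linarith [hpos 0]) (by linarith)
    have h4 : c / 2 * ‖y‖ ^ 2 = -d := by
      rw [h3]
      have hc' := hc.ne
      field_simp
    linarith
  · subst hc
    have ha : a = 0 := by
      by_contra ha
      -- A zero of the affine function `d + ⟪a, x⟫`.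
      have h1 := hpos (-(d / ‖a‖ ^ 2) • a)
      rw [hca, real_inner_smul_right, real_inner_self_eq_norm_sq] at h1
      have h2 : ‖a‖ ≠ 0 := norm_ne_zero_iff.2 ha
      have h3 : -(d / ‖a‖ ^ 2) * ‖a‖ ^ 2 = -d := by field_simp
      rw [h3] at h1
      simp at h1
    rw [hca, ha]; simp
  · exfalso
    -- The minimum of the quadratic polynomial. Growth away from it bounds `f`, contradicting
    -- surjectivity.
    set x₀ := -(c⁻¹ • a) with hx₀
    have hq : ∀ y, invFactor s (x₀ + y) = invFactor s x₀ + c / 2 * ‖y‖ ^ 2 := by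
      intro y
      have h1 : ⟪x₀, y⟫ = -(c⁻¹ * ⟪a, y⟫) := by
        rw [hx₀, inner_neg_left, real_inner_smul_left]
      rw [hca (x₀ + y), hca x₀, norm_add_sq_real, inner_add_right, h1]
      field_simp
      ring
    set m := min (invFactor s x₀) (c / 2) with hm
    have hm0 : 0 < m := lt_min (hpos x₀) (by linarith)
    have hM : ∀ y, (invFactor s (x₀ + y))⁻¹ ≤ m⁻¹ * (1 / (1 + ‖y‖ ^ 2)) := by
      intro y
      rw [one_div, ← mul_inv]
      refine inv_anti₀ (by positivity) ?_
      rw [hq, mul_add, mul_one]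
      exact add_le_add (min_le_left _ _)
        (mul_le_mul_of_nonneg_right (min_le_right _ _) (by positivity))
    have hb := h.norm_sub_le_of_quadratic_bound hM (by positivity)
    obtain ⟨z, hz⟩ := exists_norm_eq V (c := m⁻¹ * (Real.pi / 2) + 1) (by positivity)
    obtain ⟨y, hy⟩ := hf (f x₀ + z)
    have h1 := hb (y - x₀)
    rw [add_sub_cancel, hy, add_sub_cancel_left, hz] at h1
    linarith

/-- Once the factor is constant, the Koszul identity makes all second derivatives of `f` vanish. -/
theorem fderiv_eq_of_surjective (h : ConformalData f s) (hV : 3 ≤ Module.finrank ℝ V)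
    (hf : Function.Surjective f) (x : V) : fderiv ℝ f x = fderiv ℝ f 0 := by
  have h0 : ∀ u, dirDeriv u (invFactor s) = 0 := by
    intro u
    have h1 : invFactor s = fun _ => invFactor s 0 := funext (h.invFactor_eq_of_surjective hV hf)
    rw [h1]
    funext x
    simp [dirDeriv]
  have h1 : ∀ u x, dirDeriv u s x = 0 := by
    intro u x
    have h2 := h.invFactor_mul_dirDeriv u x
    rw [h0, Pi.zero_apply, mul_zero] at h2
    exact (mul_eq_zero.1 h2).resolve_left (h.invFactor_pos x).ne'
  ext u
  refine eq_of_dirDeriv_eq_zero (h.smooth.dirDeriv u) (fun v => funext fun y => ?_) x 0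
  refine h.eq_zero_of_inner_dirDeriv (x := y) fun w => ?_
  have h2 := h.inner_dirDeriv_dirDeriv u v w y
  simp only [h1] at h2
  linarith

end ConformalData

/-- Liouville's theorem for conformal bijections of a Euclidean space of dimension at least `3`. -/
theorem fderiv_eq_of_conformal [FiniteDimensional ℝ V] (hV : 3 ≤ Module.finrank ℝ V) {f : V → V}
    (hf : ContDiff ℝ ∞ f) (hc : Conformal f) (hs : Function.Surjective f) (x : V) :
    fderiv ℝ f x = fderiv ℝ f 0 := by
  have : Nontrivial V := Module.nontrivial_of_finrank_pos (R := ℝ) (by omega)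
  obtain ⟨s, h⟩ := exists_conformalData hf hc
  exact h.fderiv_eq_of_surjective hV hs x

end Liouville

end Twistor

end

noncomputable section

namespace Twistor

variable {n : ℕ}

/-! ### The Clifford relations -/

theorem sgn_mul_self (i : Fin n) (I : Finset (Fin n)) : sgn i I * sgn i I = 1 := by
  rw [sgn, ← mul_pow]; simp

theorem neg_one_pow_card_symmDiff_singleton (S : Finset (Fin n)) (j : Fin n) :
    (-1 : ℂ) ^ (symmDiff S {j}).card = -(-1) ^ S.card := by
  by_cases hj : j ∈ S
  · have h1 : symmDiff S {j} = S.erase j := by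
      ext x; by_cases hx : x = j <;> simp [Finset.mem_symmDiff, hx, hj]
    rw [h1, ← Finset.card_erase_add_one hj, pow_succ]; ring
  · have h1 : symmDiff S {j} = insert j S := by
      ext x; by_cases hx : x = j <;> simp [Finset.mem_symmDiff, hx, hj]
    rw [h1, Finset.card_insert_of_notMem hj, pow_succ]; ring

theorem sgn_symmDiff_of_lt {i j : Fin n} (h : j < i) (I : Finset (Fin n)) :
    sgn i (symmDiff I {j}) = -sgn i I := by
  have h1 : (symmDiff I {j}).filter (· < i) = symmDiff (I.filter (· < i)) {j} := by
    ext x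
    by_cases hx : x = j <;> simp [Finset.mem_symmDiff, hx, h]
  rw [sgn, h1, neg_one_pow_card_symmDiff_singleton, sgn]

theorem sgn_symmDiff_of_le {i j : Fin n} (h : i ≤ j) (I : Finset (Fin n)) :
    sgn i (symmDiff I {j}) = sgn i I := by
  have h1 : (symmDiff I {j}).filter (· < i) = I.filter (· < i) := by
    ext x
    by_cases hx : x = j
    · simp [hx, h.not_gt]
    · simp [Finset.mem_symmDiff, hx]
  rw [sgn, h1, sgn]

/-- The index `i` of `e_i` and of `e_{n+i}`. -/
def idx : Idx n → Fin n := Sum.elim id id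

/-- The coefficients of the matrices `gamma a`. -/
def gammaCoeff (a : Idx n) (I : Finset (Fin n)) : ℂ :=
  Sum.elim (fun i => sgn i I * (if i ∈ I then 1 else -1)) (fun i => Complex.I * sgn i I) a

theorem gamma_apply (a : Idx n) (ψ : Spinor n) (I : Finset (Fin n)) :
    gamma a ψ I = gammaCoeff a I * ψ (symmDiff I {idx a}) := by
  cases a <;> rfl

theorem gammaCoeff_symmDiff_of_lt {a b : Idx n} (h : idx b < idx a) (I : Finset (Fin n)) :
    gammaCoeff a (symmDiff I {idx b}) = -gammaCoeff a I := by
  cases a with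
  | inl i =>
    have h2 : i ∈ symmDiff I {idx b} ↔ i ∈ I := by
      have : i ≠ idx b := (show idx b < i from h).ne'
      simp [Finset.mem_symmDiff, this]
    simp only [gammaCoeff, Sum.elim_inl, sgn_symmDiff_of_lt (show idx b < i from h), h2, neg_mul]
  | inr i =>
    simp only [gammaCoeff, Sum.elim_inr, sgn_symmDiff_of_lt (show idx b < i from h), mul_neg]

theorem gammaCoeff_symmDiff_of_gt {a b : Idx n} (h : idx a < idx b) (I : Finset (Fin n)) :
    gammaCoeff a (symmDiff I {idx b}) = gammaCoeff a I := by
  cases a with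
  | inl i =>
    have h2 : i ∈ symmDiff I {idx b} ↔ i ∈ I := by
      have : i ≠ idx b := (show i < idx b from h).ne
      simp [Finset.mem_symmDiff, this]
    simp only [gammaCoeff, Sum.elim_inl, sgn_symmDiff_of_le (show i < idx b from h).le, h2]
  | inr i =>
    simp only [gammaCoeff, Sum.elim_inr, sgn_symmDiff_of_le (show i < idx b from h).le]

theorem gamma_mul_gamma_apply (a b : Idx n) (ψ : Spinor n) (I : Finset (Fin n)) :
    (gamma a * gamma b) ψ I = gammaCoeff a I * gammaCoeff b (symmDiff I {idx a})
      * ψ (symmDiff (symmDiff I {idx a}) {idx b}) := by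
  rw [Module.End.mul_apply, gamma_apply, gamma_apply, mul_assoc]

theorem gammaCoeff_inl (i : Fin n) (I : Finset (Fin n)) :
    gammaCoeff (Sum.inl i) I = sgn i I * (if i ∈ I then 1 else -1) := rfl

theorem gammaCoeff_inr (i : Fin n) (I : Finset (Fin n)) :
    gammaCoeff (Sum.inr i) I = Complex.I * sgn i I := rfl

theorem mem_symmDiff_singleton_self (i : Fin n) (I : Finset (Fin n)) :
    i ∈ symmDiff I {i} ↔ i ∉ I := by
  simp [Finset.mem_symmDiff]

/-- If the underlying indices differ, toggling the smaller one flips the sign in the coefficient of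
the larger one and not conversely, so the products anticommute. The four cases with equal index are
checked directly. -/
theorem gamma_mul_gamma_add (a b : Idx n) :
    gamma a * gamma b + gamma b * gamma a = if a = b then (-2 : ℂ) • 1 else 0 := by
  refine LinearMap.ext fun ψ => funext fun I => ?_
  rw [LinearMap.add_apply, Pi.add_apply, gamma_mul_gamma_apply, gamma_mul_gamma_apply]
  rcases lt_trichotomy (idx a) (idx b) with h | h | h
  · rw [gammaCoeff_symmDiff_of_lt h, gammaCoeff_symmDiff_of_gt h,
      symmDiff_right_comm, if_neg (fun hab => h.ne (congrArg idx hab))]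
    simp; ring
  · have hss : symmDiff (symmDiff I {idx b}) {idx b} = I := symmDiff_symmDiff_cancel_right _ _
    rw [h, hss]
    have h2 : (((-2 : ℂ) • (1 : Module.End ℂ (Spinor n))) ψ) I = -2 * ψ I := rfl
    have hs := fun i => sgn_mul_self i I
    cases a with
    | inl i =>
      cases b with
      | inl j =>
        obtain rfl : i = j := h
        rw [if_pos rfl, h2]
        simp only [gammaCoeff_inl, idx, Sum.elim_inl, id, sgn_symmDiff_of_le le_rfl,
          mem_symmDiff_singleton_self]
        by_cases hi : i ∈ I <;> simp [hi] <;> linear_combination (-2 * ψ I) * hs i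
      | inr j =>
        obtain rfl : i = j := h
        simp only [gammaCoeff_inl, gammaCoeff_inr, idx, Sum.elim_inr, id,
          sgn_symmDiff_of_le le_rfl, mem_symmDiff_singleton_self]
        by_cases hi : i ∈ I <;> simp [hi] <;> ring
    | inr i =>
      cases b with
      | inl j =>
        obtain rfl : i = j := h
        simp only [gammaCoeff_inl, gammaCoeff_inr, idx, Sum.elim_inl, id,
          sgn_symmDiff_of_le le_rfl, mem_symmDiff_singleton_self]
        by_cases hi : i ∈ I <;> simp [hi] <;> ring
      | inr j =>
        obtain rfl : i = j := h
        rw [if_pos rfl, h2]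
        simp only [gammaCoeff_inr, idx, Sum.elim_inr, id, sgn_symmDiff_of_le le_rfl]
        linear_combination (2 * Complex.I ^ 2 * ψ I) * hs i + 2 * ψ I * Complex.I_sq
  · rw [gammaCoeff_symmDiff_of_lt h, gammaCoeff_symmDiff_of_gt h,
      symmDiff_right_comm, if_neg (fun hab => h.ne' (congrArg idx hab))]
    simp; ring

theorem cliff_mul_self (v : Idx n → ℂ) : cliff v * cliff v = -((∑ a, v a ^ 2) • 1) := by
  have h1 : cliff v * cliff v = ∑ a, ∑ b, (v a * v b) • (gamma a * gamma b) := by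
    simp only [cliff, Finset.sum_mul_sum, smul_mul_smul_comm]
  have h2 : cliff v * cliff v = ∑ a, ∑ b, (v a * v b) • (gamma b * gamma a) := by
    rw [h1, Finset.sum_comm]
    exact Finset.sum_congr rfl fun a _ => Finset.sum_congr rfl fun b _ => by rw [mul_comm (v a)]
  have h3 : (2 : ℂ) • (cliff v * cliff v) = (2 : ℂ) • -((∑ a, v a ^ 2) • 1) := by
    rw [two_smul]
    nth_rewrite 1 [h1]
    rw [h2, ← Finset.sum_add_distrib]
    simp only [← Finset.sum_add_distrib, ← smul_add, gamma_mul_gamma_add]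
    simp only [smul_ite, smul_zero, Finset.sum_ite_eq, Finset.mem_univ, if_true]
    simp only [smul_smul]
    have h4 : (2 : ℂ) • -((∑ a, v a ^ 2) • (1 : Module.End ℂ (Spinor n)))
        = ((∑ a, v a ^ 2) * -2) • 1 := by module
    rw [h4, ← Finset.sum_smul, Finset.sum_mul]
    simp only [sq]
  exact smul_right_injective _ (two_ne_zero) h3

theorem rcliff_mul_self (v : E n) (hv : ‖v‖ = 1) : rcliff v * rcliff v = -1 := by
  rw [rcliff, cliff_mul_self]
  have h1 : ∑ a, (v a : ℂ) ^ 2 = 1 := by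
    have h2 := EuclideanSpace.real_norm_sq_eq v
    rw [hv, one_pow] at h2
    exact_mod_cast h2.symm
  rw [h1, one_smul]

theorem rcliff_e (a : Idx n) : rcliff (e a) = gamma a := by
  rw [rcliff, cliff, Finset.sum_eq_single a]
  · simp [e]
  · intro b _ hb
    simp [e, hb]
  · simp

/-- A unit vector squares to `-1`, so its determinant squares to a sign. This later confines the
scalar between two lifts to a finite set. -/
theorem det_pow_four_of_mem_Pin {T : Module.End ℂ (Spinor n)} (hT : T ∈ Pin n) :
    LinearMap.det T ^ 4 = 1 := by
  induction hT using Submonoid.closure_induction with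
  | mem T hT =>
    obtain ⟨v, hv, rfl⟩ := hT
    have h1 : LinearMap.det (rcliff v) ^ 2 = (-1) ^ Module.finrank ℂ (Spinor n) := by
      rw [sq, ← map_mul, rcliff_mul_self v hv, ← neg_one_smul ℂ (1 : Module.End ℂ (Spinor n)),
        LinearMap.det_smul, map_one, mul_one]
    rw [show (4 : ℕ) = 2 * 2 from rfl, pow_mul, h1, ← pow_mul, mul_comm, pow_mul]
    simp
  | one => simp
  | mul S T _ _ hS hT => rw [map_mul, mul_pow, hS, hT, one_mul]

theorem isUnit_of_mem_Pin {T : Module.End ℂ (Spinor n)} (hT : T ∈ Pin n) : IsUnit T := by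
  rw [LinearMap.isUnit_iff_isUnit_det, isUnit_iff_ne_zero]
  intro h
  have := det_pow_four_of_mem_Pin hT
  rw [h] at this
  simp at this

/-! ### Irreducibility of the spin module -/

theorem gamma_inl_mul_gamma_inr_apply (i : Fin n) (ψ : Spinor n) (I : Finset (Fin n)) :
    (gamma (Sum.inl i) * gamma (Sum.inr i)) ψ I
      = Complex.I * (if i ∈ I then 1 else -1) * ψ I := by
  rw [gamma_mul_gamma_apply]
  simp only [gammaCoeff_inl, gammaCoeff_inr, idx, Sum.elim_inl, Sum.elim_inr, id,
    sgn_symmDiff_of_le le_rfl, symmDiff_symmDiff_cancel_right]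
  linear_combination (Complex.I * (if i ∈ I then 1 else -1) * ψ I) * sgn_mul_self i I

/-- Schur's lemma by weights. The products `e_i e_{n+i}` are diagonal and their joint eigenvalues
separate the `θ_I`, so `T` is diagonal; commuting with each `e_i`, which moves `θ_I` to a multiple
of its neighbour, makes the diagonal constant. -/
theorem exists_smul_of_commute {T : Module.End ℂ (Spinor n)}
    (hT : ∀ a ψ, T (gamma a ψ) = gamma a (T ψ)) : ∃ c : ℂ, ∀ ψ, T ψ = c • ψ := by
  let θ : Finset (Fin n) → Spinor n := fun I => Pi.single I 1
  have hdiag : ∀ (i : Fin n) (I : Finset (Fin n)),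
      (gamma (Sum.inl i) * gamma (Sum.inr i)) (θ I)
        = (Complex.I * (if i ∈ I then 1 else -1)) • θ I := by
    intro i I
    funext J
    rw [gamma_inl_mul_gamma_inr_apply]
    by_cases hJ : J = I
    · subst hJ; simp
    · simp [θ, hJ]
  have hoff : ∀ I J, J ≠ I → T (θ I) J = 0 := by
    intro I J hJI
    obtain ⟨i, hi⟩ : ∃ i, ¬(i ∈ J ↔ i ∈ I) := by
      by_contra h
      push Not at h
      exact hJI (Finset.ext h)
    have h1 : T ((gamma (Sum.inl i) * gamma (Sum.inr i)) (θ I))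
        = (gamma (Sum.inl i) * gamma (Sum.inr i)) (T (θ I)) := by
      simp only [Module.End.mul_apply, hT]
    rw [hdiag, map_smul] at h1
    have h2 := congrFun h1 J
    rw [gamma_inl_mul_gamma_inr_apply, Pi.smul_apply, smul_eq_mul] at h2
    by_cases hiJ : i ∈ J <;> by_cases hiI : i ∈ I <;> simp [hiJ, hiI] at hi h2 <;>
    · first
      | exact self_eq_neg.1 (mul_left_cancel₀ Complex.I_ne_zero (by linear_combination h2))
      | exact self_eq_neg.1 (mul_left_cancel₀ Complex.I_ne_zero (by linear_combination -h2))
  have hstep : ∀ (i : Fin n) (I : Finset (Fin n)),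
      T (θ (symmDiff I {i})) (symmDiff I {i}) = T (θ I) I := by
    intro i I
    have h0 : gamma (Sum.inl i) (θ I) = gammaCoeff (Sum.inl i) (symmDiff I {i}) •
        θ (symmDiff I {i}) := by
      funext J
      rw [gamma_apply]
      by_cases hJ : J = symmDiff I {i}
      · subst hJ; simp [θ, idx]
      · have : symmDiff J {i} ≠ I := fun h => hJ (by rw [← h, symmDiff_symmDiff_cancel_right])
        simp [θ, idx, hJ, this]
    have h1 := congrFun (hT (Sum.inl i) (θ I)) (symmDiff I {i})
    rw [h0, map_smul, gamma_apply, Pi.smul_apply, smul_eq_mul] at h1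
    have h2 : gammaCoeff (Sum.inl i) (symmDiff I {i}) ≠ 0 := by
      intro h
      have h3 := sgn_mul_self i (symmDiff I {i})
      rw [gammaCoeff_inl] at h
      rcases mul_eq_zero.1 h with h | h
      · rw [h] at h3; simp at h3
      · split_ifs at h <;> simp at h
    have h4 := mul_left_cancel₀ h2 h1
    simpa [idx] using h4
  have hconst : ∀ I, T (θ I) I = T (θ ∅) ∅ := by
    intro I
    induction I using Finset.induction_on with
    | empty => rfl
    | insert i I hi ih =>
      rw [← ih, ← hstep i I]
      have : symmDiff I {i} = insert i I := by
        ext x; by_cases hx : x = i <;> simp [Finset.mem_symmDiff, hx, hi]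
      rw [this]
  refine ⟨T (θ ∅) ∅, fun ψ => ?_⟩
  have hT' : T = T (θ ∅) ∅ • LinearMap.id := by
    refine LinearMap.pi_ext' fun I => LinearMap.ext_ring ?_
    funext J
    by_cases hJ : J = I
    · subst hJ
      simpa [θ] using hconst J
    · simpa [θ, hJ] using hoff I J hJ
  conv_lhs => rw [hT']
  rfl

/-! ### Rigidity of lifts to the pin group -/

/-- Two lifts of the same similarity differ by a scalar, by Schur's lemma, and determinants show
that this scalar is a root of unity of fixed order. Being continuous on a connected space with
values in a finite set, it is constant. -/
theorem IsPinLift.eq_of_fderiv_eq {f : E n → E n} {δ : ℤˣ} {S : E n → Module.End ℂ (Spinor n)}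
    (hS : IsPinLift f δ S) (hf : ∀ x, fderiv ℝ f x = fderiv ℝ f 0) (hf0 : fderiv ℝ f 0 ≠ 0)
    (x : E n) : S x = S 0 := by
  obtain ⟨R, hR⟩ := isUnit_iff_exists.1 (isUnit_of_mem_Pin (hS.mem 0))
  have hRS : ∀ ψ, R (S 0 ψ) = ψ := fun ψ => LinearMap.congr_fun hR.2 ψ
  have hSR : ∀ ψ, S 0 (R ψ) = ψ := fun ψ => LinearMap.congr_fun hR.1 ψ
  have hA : (‖fderiv ℝ f 0‖ : ℂ) ≠ 0 := by
    simpa using hf0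
  have hcov : ∀ x a ψ, S x (gamma a ψ) = ((‖fderiv ℝ f 0‖ : ℂ)⁻¹ * ((δ : ℤ) : ℂ)) •
      rcliff (fderiv ℝ f 0 (e a)) (S x ψ) := by
    intro x a ψ
    have h1 := hS.covers x (e a) ψ
    rw [hf, rcliff_e] at h1
    rw [mul_smul, ← h1, smul_smul, inv_mul_cancel₀ hA, one_smul]
  have hcomm : ∀ x, ∃ c : ℂ, ∀ ψ, (R * S x) ψ = c • ψ := by
    intro x
    refine exists_smul_of_commute fun a ψ => ?_
    have h1 := hcov 0 a (R (S x ψ))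
    rw [hSR, ← hcov x a ψ] at h1
    have h2 := congrArg R h1
    rw [hRS] at h2
    exact h2.symm
  choose c hc using hcomm
  have hSc : ∀ x, S x = c x • S 0 := fun x => LinearMap.ext fun ψ => by
    rw [LinearMap.smul_apply, ← map_smul, ← hc x ψ]
    exact (hSR _).symm
  have hcc : Continuous c := by
    have h1 : c = fun x => (R : Spinor n →ₗ[ℂ] Spinor n) (S x (Pi.single ∅ 1)) ∅ := by
      funext x
      have h2 := congrFun (hc x (Pi.single ∅ 1)) ∅
      simp only [Pi.smul_apply, Pi.single_eq_same, smul_eq_mul, mul_one] at h2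
      exact h2.symm
    rw [h1]
    exact (continuous_apply ∅).comp
      ((LinearMap.continuous_of_finiteDimensional (R : Spinor n →ₗ[ℂ] Spinor n)).comp (hS.cont _))
  have hd : 0 < Module.finrank ℂ (Spinor n) := Module.finrank_pos
  have hroot : ∀ x, c x ^ (Module.finrank ℂ (Spinor n) * 4) = 1 := by
    intro x
    have h1 := det_pow_four_of_mem_Pin (hS.mem x)
    rw [hSc x, LinearMap.det_smul, mul_pow, det_pow_four_of_mem_Pin (hS.mem 0), mul_one,
      ← pow_mul] at h1
    exact h1
  have hfin : Set.Finite {z : ℂ | z ^ (Module.finrank ℂ (Spinor n) * 4) = 1} := by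
    refine (Polynomial.nthRoots (Module.finrank ℂ (Spinor n) * 4) (1 : ℂ)).toFinset.finite_toSet.subset
      fun z hz => ?_
    simpa [Polynomial.mem_nthRoots (show 0 < Module.finrank ℂ (Spinor n) * 4 by omega)] using hz
  have hcx : c x = c 0 :=
    isPreconnected_univ.constant_of_mapsTo hfin.isDiscrete hcc.continuousOn (fun y _ => hroot y)
      trivial trivial
  rw [hSc x, hcx, ← hSc 0]

end Twistor

end

noncomputable section

namespace Twistor

variable {n k K : ℕ}

/-! ### Tensor powers of endomorphisms -/

theorem tmap_mul (K : ℕ) (S T : Module.End ℂ (Spinor n)) :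
    tmap K (S * T) = tmap K S * tmap K T := by
  have hST : ∀ I I', (S * T) (Pi.single I' 1) I
      = ∑ J, S (Pi.single J 1) I * T (Pi.single I' 1) J := by
    intro I I'
    have h := congrFun (congrFun (LinearMap.toMatrix'_mul S T) I) I'
    simpa only [Matrix.mul_apply, LinearMap.toMatrix'_apply] using h
  rw [tmap, tmap, tmap, Module.End.mul_eq_comp (Matrix.toLin' _), ← Matrix.toLin'_mul]
  congr 1
  ext I I'
  simp only [Matrix.of_apply, Matrix.mul_apply, hST, ← Finset.prod_mul_distrib]
  rw [Finset.prod_univ_sum, Fintype.piFinset_univ]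

theorem tmap_one (K : ℕ) : tmap K (1 : Module.End ℂ (Spinor n)) = 1 := by
  have h : (Matrix.of fun I I' : Fin K → Finset (Fin n) =>
      ∏ j, (1 : Module.End ℂ (Spinor n)) (Pi.single (I' j) 1) (I j)) = 1 := by
    ext I I'
    simp only [Matrix.of_apply, Module.End.one_apply, Pi.single_apply, Matrix.one_apply]
    by_cases hI : I = I'
    · simp [hI]
    · obtain ⟨j, hj⟩ := Function.ne_iff.1 hI
      rw [if_neg hI]
      exact Finset.prod_eq_zero (Finset.mem_univ j) (if_neg hj)
  rw [tmap, h, Matrix.toLin'_one]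
  rfl

theorem isUnit_tmap (K : ℕ) {T : Module.End ℂ (Spinor n)} (hT : IsUnit T) : IsUnit (tmap K T) := by
  obtain ⟨R, h1, h2⟩ := isUnit_iff_exists.1 hT
  exact isUnit_iff_exists.2 ⟨tmap K R, by rw [← tmap_mul, h1, tmap_one],
    by rw [← tmap_mul, h2, tmap_one]⟩

/-! ### Transport of tangent vectors by a linear similarity -/

/-- The complex matrices `P` and `Q = P⁻¹` of a linear similarity which maps `J` to `J'`. -/
structure Intertwines (J J' : OCS n) (P Q : CMat n) (r : ℂ) : Prop where
  mul_inv : P * Q = 1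
  inv_mul : Q * P = 1
  inv_eq : Q = r • Pᵀ
  conj : J'.cmat = P * J.cmat * Q

namespace Intertwines

variable {J J' : OCS n} {P Q : CMat n} {r : ℂ}

theorem inv_transpose (h : Intertwines J J' P Q r) : Qᵀ = r • P := by
  rw [h.inv_eq, Matrix.transpose_smul, Matrix.transpose_transpose]

theorem mem_vert (h : Intertwines J J' P Q r) (B : Vert J) : P * B.1 * Q ∈ Vert J' := by
  have h1 : B.1ᵀ = -B.1 := B.2.1
  have h2 : B.1 * J.cmat = -(J.cmat * B.1) := B.2.2
  refine ⟨?_, ?_⟩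
  · rw [Matrix.transpose_mul, Matrix.transpose_mul, h1, h.inv_transpose, Matrix.smul_mul,
      Matrix.neg_mul, Matrix.mul_neg, h.inv_eq, Matrix.mul_smul, smul_neg, Matrix.mul_assoc]
  · have h3 : ∀ X Y : CMat n, P * X * Q * (P * Y * Q) = P * (X * Y) * Q := by
      intro X Y
      calc P * X * Q * (P * Y * Q) = P * X * (Q * P) * Y * Q := by simp only [Matrix.mul_assoc]
        _ = P * (X * Y) * Q := by rw [h.inv_mul, Matrix.mul_one, Matrix.mul_assoc P]
    rw [h.conj, h3, h3, h2, Matrix.mul_neg, Matrix.neg_mul]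

/-- The map of tangent spaces `(v, B) ↦ (P v, P B P⁻¹)`. -/
def push (h : Intertwines J J' P Q r) (u : Tang J) : Tang J' :=
  (P *ᵥ u.1, ⟨P * u.2.1 * Q, h.mem_vert u.2⟩)

theorem mul_projBar (h : Intertwines J J' P Q r) : P * projBar J = projBar J' * P := by
  have h1 : J'.cmat * P = P * J.cmat := by
    rw [h.conj, Matrix.mul_assoc, h.inv_mul, Matrix.mul_one]
  simp only [projBar, Matrix.mul_smul, Matrix.smul_mul, Matrix.mul_add, Matrix.add_mul, h1,
    Matrix.mul_one, Matrix.one_mul]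

theorem projBar_transpose_mul (h : Intertwines J J' P Q r) :
    (projBar J)ᵀ * Q = r • (Pᵀ * (projBar J')ᵀ) := by
  rw [← Matrix.transpose_mul, ← h.mul_projBar, Matrix.transpose_mul, h.inv_eq, Matrix.mul_smul]

/-- Conjugation by `P` turns the basis vector in `nil_snd_coe` into `r P e_a`, because `Q = r Pᵀ`.
Summation against the row `P c a` gives `r P Pᵀ e_c = e_c`, so the scale factor disappears. -/
theorem sum_push_nil (h : Intertwines J J' P Q r) (c : Idx n) (u : Tang J) :
    ∑ a, P c a • h.push (nil J a u) = nil J' c (h.push u) := by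
  ext1
  · simp [Prod.fst_sum, push, nil_apply]
  · ext1
    have hPP : r • (P * Pᵀ) = 1 := by rw [← Matrix.mul_smul, ← h.inv_eq, h.mul_inv]
    have h1 : ∀ a, ((P c a • h.push (nil J a u)).2 : CMat n) = (2 * Complex.I) • (projBar J' *
        (r • (P * (Matrix.vecMulVec u.1 (P c a • Pi.single a 1)
          - Matrix.vecMulVec (P c a • Pi.single a 1) u.1) * Pᵀ) * (projBar J')ᵀ)) := by
      intro a
      change P c a • (P * ((nil J a u).2 : CMat n) * Q) = _
      rw [nil_snd_coe, Matrix.vecMulVec_smul, Matrix.smul_vecMulVec, ← smul_sub]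
      generalize (Matrix.vecMulVec u.1 (Pi.single a 1) - Matrix.vecMulVec (Pi.single a 1) u.1) = X
      simp only [Matrix.mul_smul, Matrix.smul_mul]
      have h2 : P * (projBar J * (X * (projBar J)ᵀ)) * Q
          = (P * projBar J) * (X * ((projBar J)ᵀ * Q)) := by simp only [Matrix.mul_assoc]
      rw [h2, h.mul_projBar, h.projBar_transpose_mul]
      simp only [Matrix.mul_smul, Matrix.mul_assoc, smul_comm (P c a)]
    have h3 : ∑ a, P c a • (Pi.single a 1 : Idx n → ℂ) = Pᵀ *ᵥ Pi.single c 1 := by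
      funext b
      simp [Finset.sum_apply, Pi.single_apply]
    have h4 : ∑ a, (Matrix.vecMulVec u.1 (P c a • Pi.single a 1)
          - Matrix.vecMulVec (P c a • Pi.single a 1) u.1)
        = Matrix.vecMulVec u.1 (Pᵀ *ᵥ Pi.single c 1) - Matrix.vecMulVec (Pᵀ *ᵥ Pi.single c 1) u.1 := by
      rw [← h3]
      ext i j
      simp only [Matrix.vecMulVec_apply, Matrix.sum_apply, Matrix.sub_apply, Pi.smul_apply,
        Finset.sum_sub_distrib, Finset.mul_sum, Finset.sum_mul, Finset.sum_apply]
    rw [Prod.snd_sum, AddSubmonoidClass.coe_finsetSum, nil_snd_coe]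
    simp only [h1]
    rw [← Finset.smul_sum, ← Matrix.mul_sum, ← Matrix.sum_mul, ← Finset.smul_sum,
      ← Matrix.sum_mul, ← Matrix.mul_sum, h4]
    congr 4
    rw [Matrix.mul_sub, Matrix.sub_mul, Matrix.mul_vecMulVec, Matrix.mul_vecMulVec,
      Matrix.vecMulVec_mul, Matrix.vecMulVec_mul, Matrix.mulVec_mulVec, Matrix.vecMul_transpose,
      Matrix.vecMul_transpose, Matrix.mulVec_mulVec, smul_sub, ← Matrix.vecMulVec_smul,
      ← Matrix.smul_vecMulVec, ← Matrix.smul_mulVec, hPP, Matrix.one_mulVec]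
    rfl

end Intertwines

/-! ### Constant differentials -/

theorem map_ofReal_mul (X Y : RMat n) :
    (X * Y).map Complex.ofReal = X.map Complex.ofReal * Y.map Complex.ofReal := by
  ext i j; simp [Matrix.mul_apply]

theorem eq_sum_smul_e (v : E n) : v = ∑ a, v a • e a := by
  ext b
  rw [WithLp.ofLp_sum, Finset.sum_apply, Finset.sum_eq_single b]
  · simp [e]
  · intro a _ hab
    simp [e, hab.symm]
  · simp

theorem fderiv_apply_eq_jac_mulVec (f : E n → E n) (x v : E n) (b : Idx n) :
    fderiv ℝ f x v b = ∑ a, jac f x b a * v a := by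
  conv_lhs => rw [eq_sum_smul_e v, map_sum]
  simp [jac, mul_comm]

section Constant

variable {f : E n → E n}

theorem apply_add_of_fderiv_eq (hf : Differentiable ℝ f)
    (hA : ∀ x, fderiv ℝ f x = fderiv ℝ f 0) (x v : E n) : f (x + v) = f x + fderiv ℝ f 0 v := by
  have h1 : ∀ y z, f y - fderiv ℝ f 0 y = f z - fderiv ℝ f 0 z := by
    refine is_const_of_fderiv_eq_zero (𝕜 := ℝ) (f := fun y => f y - fderiv ℝ f 0 y)
      (hf.sub (fderiv ℝ f 0).differentiable) fun y => ?_
    rw [fderiv_fun_sub (hf y) (fderiv ℝ f 0).differentiableAt, ContinuousLinearMap.fderiv, hA,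
      sub_self]
  have h2 := h1 (x + v) x
  rw [map_add] at h2
  have h3 : f (x + v) = f x - fderiv ℝ f 0 x + (fderiv ℝ f 0 x + fderiv ℝ f 0 v) := by
    rw [← h2]; abel
  rw [h3]; abel

theorem jac_eq_of_fderiv_eq (hA : ∀ x, fderiv ℝ f x = fderiv ℝ f 0) (x : E n) : jac f x = jac f 0 := by
  ext a b
  simp only [jac, hA x]

theorem fderiv_lift_apply (hf : Differentiable ℝ f)
    (hA : ∀ x, fderiv ℝ f x = fderiv ℝ f 0) (x : E n) (M : RMat n) (v : E n) (B : RMat n) :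
    fderiv ℝ (lift f) (x, M) (v, B) = (fderiv ℝ f 0 v, jac f 0 * B * (jac f 0)⁻¹) := by
  let L : RMat n →L[ℝ] RMat n := LinearMap.toContinuousLinearMap
    (LinearMap.mulRight ℝ (jac f 0)⁻¹ ∘ₗ LinearMap.mulLeft ℝ (jac f 0))
  have hL : lift f = fun p : E n × RMat n => (f p.1, L p.2) := by
    funext p
    rw [lift, jac_eq_of_fderiv_eq hA]
    rfl
  have h1 : HasFDerivAt (fun p : E n × RMat n => (f p.1, L p.2))
      (((fderiv ℝ f x).comp (ContinuousLinearMap.fst ℝ _ _)).prod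
        (L.comp (ContinuousLinearMap.snd ℝ _ _))) (x, M) :=
    ((hf x).hasFDerivAt.comp (x, M) hasFDerivAt_fst).prodMk
      (L.hasFDerivAt.comp (x, M) hasFDerivAt_snd)
  rw [hL, h1.fderiv, hA]
  rfl

theorem dlift_eq (hf : Differentiable ℝ f)
    (hA : ∀ x, fderiv ℝ f x = fderiv ℝ f 0) (x : E n) (J : OCS n) (v : Idx n → ℂ) (B : CMat n) :
    dlift f x J v B = ((jac f 0).map Complex.ofReal *ᵥ v,
      (jac f 0).map Complex.ofReal * B * (jac f 0)⁻¹.map Complex.ofReal) := by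
  rw [dlift]
  simp only [fderiv_lift_apply hf hA]
  have hB : B = (B.map Complex.re).map Complex.ofReal
      + Complex.I • (B.map Complex.im).map Complex.ofReal := by
    ext i j
    simp [mul_comm Complex.I, Complex.re_add_im]
  refine Prod.ext ?_ ?_
  · funext b
    simp only [fderiv_apply_eq_jac_mulVec, Matrix.mulVec, dotProduct, Matrix.map_apply]
    push_cast
    rw [Finset.mul_sum, ← Finset.sum_add_distrib]
    refine Finset.sum_congr rfl fun a _ => ?_
    conv_rhs => rw [← Complex.re_add_im (v a)]
    ring
  · conv_rhs => rw [hB]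
    simp only [map_ofReal_mul, Matrix.mul_add, Matrix.add_mul, Matrix.mul_smul, Matrix.smul_mul]

end Constant

end Twistor

end

noncomputable section

namespace Twistor

variable {n k K : ℕ}

/-! ### Matrices of similarities -/

theorem exists_jac_transpose_mul {f : E n → E n} {x : E n} (hf : DifferentiableAt ℝ f x)
    (hc : ConformalAt f x) : ∃ c : ℝ, 0 < c ∧ (jac f x)ᵀ * jac f x = c • 1 := by
  obtain ⟨c, hc0, hc⟩ := (conformalAt_iff hf.hasFDerivAt).1 hc
  refine ⟨c, hc0, ?_⟩
  ext a b
  have h := hc (e a) (e b)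
  rw [PiLp.inner_apply] at h
  have h2 : inner ℝ (e a) (e b) = if a = b then (1 : ℝ) else 0 := by
    simp [e, EuclideanSpace.inner_single_left]
  rw [h2] at h
  rw [Matrix.mul_apply, Matrix.smul_apply, Matrix.one_apply, smul_eq_mul, ← h]
  simp [jac, mul_comm]

section Similarity

variable {A : RMat n} {c : ℝ}

theorem inv_eq_of_transpose_mul (hc : 0 < c) (hA : Aᵀ * A = c • 1) : A⁻¹ = c⁻¹ • Aᵀ :=
  Matrix.inv_eq_left_inv (by rw [Matrix.smul_mul, hA, smul_smul, inv_mul_cancel₀ hc.ne', one_smul])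

theorem intertwines_of_transpose_mul (hc : 0 < c) (hA : Aᵀ * A = c • 1) {J J' : OCS n}
    (hJ : J'.mat = A * J.mat * A⁻¹) :
    Intertwines J J' (A.map Complex.ofReal) (A⁻¹.map Complex.ofReal) (c⁻¹ : ℝ) := by
  have h1 : A⁻¹ * A = 1 := by
    rw [inv_eq_of_transpose_mul hc hA, Matrix.smul_mul, hA, smul_smul, inv_mul_cancel₀ hc.ne',
      one_smul]
  have hone : (1 : RMat n).map Complex.ofReal = 1 :=
    Matrix.map_one _ Complex.ofReal_zero Complex.ofReal_one
  refine ⟨?_, ?_, ?_, ?_⟩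
  · rw [← map_ofReal_mul, mul_eq_one_comm.1 h1, hone]
  · rw [← map_ofReal_mul, h1, hone]
  · rw [inv_eq_of_transpose_mul hc hA]
    ext i j
    simp
  · rw [OCS.cmat, hJ, map_ofReal_mul, map_ofReal_mul]; rfl

/-- Conjugation by `A` equals conjugation by the orthogonal matrix `A / √c`, whose determinant is
`δ`. -/
theorem mem_Z_of_transpose_mul (hc : 0 < c) (hA : Aᵀ * A = c • 1) {δ ε : ℤˣ}
    (hδ : 0 < ((δ : ℤ) : ℝ) * A.det) {J J' : OCS n} (hJ : J'.mat = A * J.mat * A⁻¹)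
    (hJε : J ∈ Z n ε) : J' ∈ Z n (δ * ε) := by
  obtain ⟨g, hg, hgd, hgJ⟩ := hJε
  have hs : 0 < √c := Real.sqrt_pos.2 hc
  have hss : (√c)⁻¹ * (√c)⁻¹ = c⁻¹ := by rw [← mul_inv, Real.mul_self_sqrt hc.le]
  set R : RMat n := (√c)⁻¹ • A with hR
  have hRR : Rᵀ * R = 1 := by
    rw [hR, Matrix.transpose_smul, Matrix.smul_mul, Matrix.mul_smul, hA, smul_smul, smul_smul, hss,
      inv_mul_cancel₀ hc.ne', one_smul]
  have hRd : R.det = ((δ : ℤ) : ℝ) := by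
    have h1 : R.det * R.det = 1 := by
      have := congrArg Matrix.det hRR
      rwa [Matrix.det_mul, Matrix.det_transpose, Matrix.det_one] at this
    have h2 : 0 < ((δ : ℤ) : ℝ) * R.det := by
      rw [hR, Matrix.det_smul, mul_left_comm]
      positivity
    rcases Int.units_eq_one_or δ with rfl | rfl
    · rcases mul_self_eq_one_iff.1 h1 with h | h
      · simpa using h
      · rw [h] at h2; norm_num at h2
    · rcases mul_self_eq_one_iff.1 h1 with h | h
      · rw [h] at h2; norm_num at h2
      · simpa using h
  refine ⟨R * g, ?_, ?_, ?_⟩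
  · rw [Matrix.transpose_mul, Matrix.mul_assoc, ← Matrix.mul_assoc Rᵀ, hRR, Matrix.one_mul, hg]
  · rw [Matrix.det_mul, hRd, hgd]
    push_cast
    ring
  · rw [hJ, hgJ, inv_eq_of_transpose_mul hc hA, Matrix.transpose_mul, hR, Matrix.transpose_smul,
      ← hss]
    simp only [Matrix.smul_mul, Matrix.mul_smul, smul_smul, Matrix.mul_assoc]

end Similarity

/-! ### Conformal invariance -/

/-- Needed because `f` maps lines along `e_a` to lines in arbitrary directions. -/
theorem IsSection.hasDerivAt_line {U : Set (E n)} (hU : IsOpen U) {ε : ℤˣ} {η : Field n k K}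
    (hη : IsSection U ε η) {x : E n} (hx : x ∈ U) {J : OCS n} (hJ : J ∈ Z n ε) (u : Fin k → Tang J)
    (v : E n) :
    HasDerivAt (fun t : ℝ => (η (x + t • v) J u : TensorPow n K))
      (∑ a, (v a : ℂ) • hderiv a η x J u) 0 := by
  obtain ⟨w, c, rfl⟩ := exists_eq_fund u
  obtain ⟨L, hL⟩ := (hη w c).hasDerivAt_fderiv hU hx hJ
  have h1 : ∀ a, L (e a) = hderiv a η x J (fun i => (w i, fund (c i) J)) := fun a =>
    (hL (e a)).deriv.symm
  have h2 : L v = ∑ a, (v a : ℂ) • hderiv a η x J (fun i => (w i, fund (c i) J)) := by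
    conv_lhs => rw [eq_sum_smul_e v, map_sum]
    simp only [map_smul, h1, Complex.coe_smul]
  rw [← h2]
  exact hL v

theorem isPullback_D (hn : 2 ≤ n) {ε δ : ℤˣ} {f : E n ≃ E n} (hf : IsConformalAut f)
    (hδ : ∀ x, 0 < ((δ : ℤ) : ℝ) * (jac f x).det) {w : ℝ} {S : E n → Module.End ℂ (Spinor n)}
    (hS : IsPinLift f δ S) {η η' : Field n k K} (hη : IsSection Set.univ (δ * ε) η)
    (hp : IsPullback ε f w S η η') : IsPullback ε f w S (D η) (D η') := by
  have hdf : Differentiable ℝ f := hf.smooth.differentiable (by simp)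
  have hA : ∀ x, fderiv ℝ f x = fderiv ℝ f 0 :=
    fderiv_eq_of_conformal (by simp; omega) hf.smooth hf.conformal f.surjective
  obtain ⟨c, hc, hAA⟩ := exists_jac_transpose_mul (hdf 0) (hf.conformal.conformalAt 0)
  have hA0 : fderiv ℝ f 0 ≠ 0 := by
    intro h
    have h1 := hδ 0
    have h2 : jac f 0 = 0 := by
      ext a b; simp [jac, h]
    -- An empty matrix has determinant `1`, so the zero differential is excluded only for an
    -- inhabited index type.
    have : Nonempty (Idx n) := ⟨Sum.inl ⟨0, by omega⟩⟩
    rw [h2, Matrix.det_zero, mul_zero] at h1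
    exact lt_irrefl _ h1
  have hS0 := hS.eq_of_fderiv_eq hA hA0
  have hunit : IsUnit (tmap K (((‖fderiv ℝ f 0‖ ^ w : ℝ) : ℂ) • S 0)) := by
    refine isUnit_tmap K ?_
    have h1 : ((‖fderiv ℝ f 0‖ ^ w : ℝ) : ℂ) ≠ 0 :=
      Complex.ofReal_ne_zero.2 (Real.rpow_pos_of_pos (norm_pos_iff.2 hA0) w).ne'
    exact (isUnit_of_mem_Pin (hS.mem 0)).smul (Units.mk0 _ h1)
  obtain ⟨R, -, hR⟩ := isUnit_iff_exists.1 hunit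
  intro x J hJ J' hJJ' u u' hu
  rw [hA x, hS0 x]
  unfold IsPullback at hp
  simp only [hA, hS0] at hp
  set T := tmap K (((‖fderiv ℝ f 0‖ ^ w : ℝ) : ℂ) • S 0)
  have hRT : ∀ z, R (T z) = z := fun z => LinearMap.congr_fun hR z
  have hJ'mat : J'.mat = jac f 0 * J.mat * (jac f 0)⁻¹ := by
    have := congrArg Prod.snd hJJ'
    rwa [lift, jac_eq_of_fderiv_eq hA] at this
  have hJ' : J' ∈ Z n (δ * ε) := mem_Z_of_transpose_mul hc hAA (hδ 0) hJ'mat hJ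
  have hI := intertwines_of_transpose_mul hc hAA hJ'mat
  have hpush : ∀ (y : E n) (u : Fin k → Tang J),
      T (η' y J u : TensorPow n K) = (η (f y) J' (fun i => hI.push (u i)) : TensorPow n K) := by
    intro y u
    refine hp y J hJ J' ?_ u _ fun i => (dlift_eq hdf hA y J _ _).symm
    rw [lift, jac_eq_of_fderiv_eq hA, ← hJ'mat]
  have hu' : u' = fun i => hI.push (u i) := by
    funext i
    have h1 := hu i
    rw [dlift_eq hdf hA] at h1
    have h2 := Prod.ext_iff.1 h1
    exact Prod.ext h2.1 (Subtype.ext h2.2)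
  have hder : ∀ a (u : Fin k → Tang J), HasDerivAt
      (fun t : ℝ => T (η' (x + t • e a) J u : TensorPow n K))
      (∑ b, (jac f 0 b a : ℂ) • hderiv b η (f x) J' (fun i => hI.push (u i))) 0 := by
    intro a u
    have h1 := hη.hasDerivAt_line isOpen_univ (Set.mem_univ (f x)) hJ' (fun i => hI.push (u i))
      (fderiv ℝ f 0 (e a))
    simp only [hpush, apply_add_of_fderiv_eq hdf hA, map_smul]
    exact h1
  -- Horizontal differentiability of `η'` is inherited from `η`: the bundle map `T` does not depend
  -- on the point and has the inverse `R`.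
  have hderiv' : ∀ a (u : Fin k → Tang J), HasDerivAt
      (fun t : ℝ => (η' (x + t • e a) J u : TensorPow n K))
      (R (∑ b, (jac f 0 b a : ℂ) • hderiv b η (f x) J' (fun i => hI.push (u i)))) 0 := by
    intro a u
    have h1 := ((LinearMap.toContinuousLinearMap R).restrictScalars ℝ).hasFDerivAt.comp_hasDerivAt
      (0 : ℝ) (hder a u)
    simpa only [ContinuousLinearMap.coe_restrictScalars', Function.comp_def,
      LinearMap.coe_toContinuousLinearMap', hRT] using h1
  have hη' : HorDiff η' x J := fun a u => (hderiv' a u).differentiableAt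
  have hTR : ∀ a (u : Fin k → Tang J), T (hderiv a η' x J u)
      = ∑ b, (jac f 0 b a : ℂ) • hderiv b η (f x) J' (fun i => hI.push (u i)) := by
    intro a u
    have h1 := ((LinearMap.toContinuousLinearMap T).restrictScalars ℝ).hasFDerivAt.comp_hasDerivAt
      (0 : ℝ) (hη'.hasDerivAt a u)
    exact h1.unique (hder a u)
  have hηd := hη.horDiff isOpen_univ (Set.mem_univ (f x)) hJ'
  rw [hu', hη'.D_apply, hηd.D_apply, map_sum]
  refine Finset.sum_congr rfl fun i _ => ?_
  rw [map_sum]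
  simp only [hTR]
  rw [Finset.sum_comm]
  refine Finset.sum_congr rfl fun b _ => ?_
  let L : Tang J' →ₗ[ℂ] TensorPow n K := (linePow K J').subtype ∘ₗ
    (lie b η (f x) J').toMultilinearMap.toLinearMap (fun i => hI.push (u i)) i
  have hL : ∀ z : Tang J', hderiv b η (f x) J' (Function.update (fun i => hI.push (u i)) i z) = L z :=
    fun z => (hηd.coe_lie_apply b _).symm
  have hupd : ∀ z : Tang J, (fun j => hI.push (Function.update u i z j))
      = Function.update (fun j => hI.push (u j)) i (hI.push z) := by
    intro z
    funext j
    by_cases hj : j = i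
    · subst hj; simp
    · simp [hj]
  simp only [hupd, hL]
  -- The chain rule contributed the Jacobian coefficients in the index `a`, exactly those absorbed
  -- by the equivariance of `nil`.
  rw [← hI.sum_push_nil, map_sum]
  simp only [map_smul]
  rfl

end Twistor

end

/-! ### The three assertions combined -/

theorem lemma1 (n m : ℕ) (hn : 3 ≤ n) :
    -- conformal invariance on the twistor spaces of `ℝ^{2n}`
    (∀ (k : ℕ) (ε δ : ℤˣ) (f : Twistor.E n ≃ Twistor.E n), Twistor.IsConformalAut f →
      (∀ x, 0 < ((δ : ℤ) : ℝ) * (Twistor.jac f x).det) →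
      ∀ (w : ℝ) (S : Twistor.E n → Module.End ℂ (Twistor.Spinor n)), Twistor.IsPinLift f δ S →
      ∀ η η' : Twistor.Field n k (2 * n - 2 + m), Twistor.IsSection Set.univ (δ * ε) η →
        Twistor.IsPullback ε f w S η η' →
        Twistor.IsPullback ε f w S (Twistor.D η) (Twistor.D η')) ∧
    -- `D` preserves smooth forms of each type
    (∀ (ε : ℤˣ) (U : Set (Twistor.E n)), IsOpen U →
      ∀ (l l' : ℕ) (η : Twistor.Field n (l + l') (2 * n - 2 + m)),
        Twistor.IsTypeSection U ε l l' η → Twistor.IsTypeSection U ε l l' (Twistor.D η)) ∧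
    -- `D ^ (n + 1) = 0`, and the series `F^{(n+m-2)}(D)` is a finite sum
    (∀ (ε : ℤˣ) (U : Set (Twistor.E n)), IsOpen U →
      ∀ (k : ℕ) (η : Twistor.Field n k (2 * n - 2 + m)), Twistor.IsSection U ε η →
        ∀ x ∈ U, ∀ J ∈ Twistor.Z n ε,
          (Twistor.D^[n + 1] η) x J = 0 ∧
          HasSum
            (fun j => PowerSeries.coeff j (Twistor.Fder (n + m - 2)) • (Twistor.D^[j] η) x J)
            (∑ j ∈ Finset.range (n + 1),
              PowerSeries.coeff j (Twistor.Fder (n + m - 2)) • (Twistor.D^[j] η) x J)) := by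
  refine ⟨?_, ?_, ?_⟩
  · intro k ε δ f hf hδ w S hS η η' hη hp
    exact Twistor.isPullback_D (by omega) hf hδ hS hη hp
  · intro ε U hU l l' η hη
    exact hη.D hU
  · intro ε U hU k η hη x hx J hJ
    exact ⟨Twistor.iterate_D_eq_zero hU hη hx hJ, Twistor.hasSum_iterate_D hU hη hx hJ _⟩
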